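/- **Theorem 3.9.** Let $T>0$, let $k\ge 1$ be an integer, and let $(\omega_j)_{j\in\mathbb N}$ ($\mathbb N=\{0,1,2,\dots\}$) be a strictly increasing sequence of $[0,+\infty)$ with $\omega_0=0$ which has a polynomial asymptotic gap: there exist $\varepsilon>0$, $N_0\in\mathbb N$ and $c>0$ such that $\omega_{j+1}-\omega_j\ge c\,j^{\varepsilon}$ for all $j\ge N_0$. For $m\in\mathbb Z$ and a complex sequence $d=(d_j)_{j\in\mathbb N}$ put $$\|d\|_{h^{2m}_\omega}:=\Big(\sum_{j=0}^{+\infty}\big|(\delta_{j,0}+\omega_j^{m})\,d_j\big|^2\Big)^{1/2},$$ where for $m<0$ the weight at $j=0$ is understood to be $1$, and for $m\in\mathbb N$ let $h^{2m}_{\omega,r}(\mathbb N,\mathbb C)$ be the real normed space of all $d\in\ell^2(\mathbb N,\mathbb C)$ such that $d_0\in\mathbb R$ and $\|d\|_{h^{2m}_\omega}<+\infty$. Let $H^k_0((0,T),\mathbb R)$ be the closure of $C_c^\infty((0,T),\mathbb R)$ in the Sobolev space $H^k((0,T),\mathbb R)$. For $u\in L^1(0,T)$, define the iterated primitives $u_0:=u$,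 $u_{n+1}(t):=\int_0^t u_n(\tau)\,d\tau$. For $u\in H^k_0((0,T),\mathbb R)$ put $$\|u\|_{H^m_0(0,T)}:=\|u^{(m)}\|_{L^2(0,T)}\quad(0\le m\le k),\qquad \|u\|_{H^{-n}_0(0,T)}:=|u_1(T)|+\|u_n\|_{L^2(0,T)}\quad(n\ge1).$$ Then there exist a constant $C>0$ and a continuous ($\mathbb R$-)linear map $\mathcal M^T_k:h^{2k}_{\omega,r}(\mathbb N,\mathbb C)\to H^k_0((0,T),\mathbb R)$ such that for every $d=(d_j)_{j\in\mathbb N}\in h^{2k}_{\omega,r}(\mathbb N,\mathbb C)$ the function $u:=\mathcal M^T_k(d)$ satisfies the moment problem $$\int_0^T u(t)e^{i\omega_j t}\,dt=d_j,\qquad\forall j\in\mathbb N,$$ the boundary conditions $$u_2(T)=u_3(T)=\dots=u_{k+1}(T)=0,$$ and the estimates $$\|u\|_{H^m_0(0,T)}\le C\,\|d\|_{h^{2m}_\omega},\qquad\forall m=-(k+1),\dots,0,\dots,k.$$ -/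

import Mathlib

open MeasureTheory Set

open scoped ENNReal

noncomputable section

namespace MomentProblem

/-! ### Frequencies and weighted sequence spaces -/

/-- Polynomial asymptotic gap. -/
def AsymptGapPoly (ω : ℕ → ℝ) : Prop :=
  ∃ ε : ℝ, 0 < ε ∧ ∃ N₀ : ℕ, ∃ c : ℝ, 0 < c ∧
    ∀ j : ℕ, N₀ ≤ j → c * (j : ℝ) ^ ε ≤ ω (j + 1) - ω j

/-- The weight `δ_{j,0} + ω_j ^ m`, for an integer `m` of either sign. When `m < 0` and `ω_0 = 0`
the term `ω_0 ^ m` is `0` (as in Mathlib), so that the weight at `j = 0` is `1`. -/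
def hWeight (ω : ℕ → ℝ) (m : ℤ) (j : ℕ) : ℝ := (if j = 0 then 1 else 0) + ω j ^ m

/-- `‖d‖_{h^{2m}_ω} = (∑_j |(δ_{j,0} + ω_j ^ m) d_j|²)^{1/2}`. -/
def hNorm (ω : ℕ → ℝ) (m : ℤ) (d : ℕ → ℂ) : ℝ :=
  Real.sqrt (∑' j, ‖(hWeight ω m j : ℂ) * d j‖ ^ 2)

/-- The real vector space of the sequences `d ∈ ℓ²(ℕ, ℂ)` with `d_0 ∈ ℝ` and
`∑_j |(δ_{j,0} + ω_j ^ m) d_j|² < ∞`. -/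
def hSubmodule (ω : ℕ → ℝ) (m : ℕ) : Submodule ℝ (ℕ → ℂ) where
  carrier := {d | (d 0).im = 0 ∧ Memℓp d 2 ∧ Memℓp (fun j => (hWeight ω m j : ℂ) * d j) 2}
  zero_mem' := by
    refine ⟨by simp, zero_memℓp, ?_⟩
    have h : (fun j => (hWeight ω m j : ℂ) * (0 : ℕ → ℂ) j) = 0 := by
      funext j
      simp
    rw [h]
    exact zero_memℓp
  add_mem' := by
    rintro a b ⟨ha, ha1, ha2⟩ ⟨hb, hb1, hb2⟩
    refine ⟨by simp [ha, hb], ha1.add hb1, ?_⟩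
    have h := ha2.add hb2
    convert h using 1
    funext j
    simp [mul_add]
  smul_mem' := by
    rintro r a ⟨ha, ha1, ha2⟩
    refine ⟨by simp [ha], ha1.const_smul r, ?_⟩
    have h := ha2.const_smul r
    convert h using 1
    funext j
    simp only [Pi.smul_apply, Complex.real_smul]
    ring

/-- The space `h^{2m}_{ω,r}(ℕ, ℂ)`. It is a copy of `hSubmodule ω m`, so that its topology is the
one of the norm `‖·‖_{h^{2m}_ω}` and not the product topology of `ℕ → ℂ`. -/
def HSeq (ω : ℕ → ℝ) (m : ℕ) : Type := hSubmodule ω m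

namespace HSeq

variable {ω : ℕ → ℝ} {m : ℕ}

instance : AddCommGroup (HSeq ω m) := inferInstanceAs (AddCommGroup (hSubmodule ω m))

instance : Module ℝ (HSeq ω m) := inferInstanceAs (Module ℝ (hSubmodule ω m))

/-- The underlying sequence. -/
def seq (d : HSeq ω m) : ℕ → ℂ := (show hSubmodule ω m from d).1

theorem seq_mem (d : HSeq ω m) : d.seq ∈ hSubmodule ω m :=
  (show hSubmodule ω m from d).2

/-- Multiplication by the weight, with values in `ℓ²`. -/
def toLp : HSeq ω m →ₗ[ℝ] lp (fun _ : ℕ => ℂ) 2 where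
  toFun d := ⟨fun j => (hWeight ω m j : ℂ) * d.seq j, d.seq_mem.2.2⟩
  map_add' a b := by
    ext j
    exact mul_add _ _ _
  map_smul' r a := by
    ext j
    change (hWeight ω m j : ℂ) * (r • a.seq j) = r • ((hWeight ω m j : ℂ) * a.seq j)
    simp only [Complex.real_smul]
    ring

/-- The norm `‖·‖_{h^{2m}_ω}` (see `HSeq.norm_eq`). For an arbitrary sequence `ω` this is a
seminorm; it is a norm as soon as `ω_0 = 0` and `ω_j > 0` for `j ≥ 1` (see `HSeq.eq_zero`). -/
instance : SeminormedAddCommGroup (HSeq ω m) :=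
  SeminormedAddCommGroup.induced (HSeq ω m) (lp (fun _ : ℕ => ℂ) 2) toLp

instance : NormedSpace ℝ (HSeq ω m) :=
  NormedSpace.induced ℝ (HSeq ω m) (lp (fun _ : ℕ => ℂ) 2) toLp

theorem norm_eq (d : HSeq ω m) : ‖d‖ = hNorm ω m d.seq := by
  change ‖toLp d‖ = _
  rw [lp.norm_eq_tsum_rpow (by norm_num), hNorm, Real.sqrt_eq_rpow]
  simp [toLp]

theorem eq_zero (h0 : ω 0 = 0) (hpos : ∀ j, j ≠ 0 → 0 < ω j) (d : HSeq ω m) (hd : ‖d‖ = 0) :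
    d = 0 := by
  have h1 : toLp d = 0 := norm_eq_zero.mp hd
  apply Subtype.ext
  funext j
  have h2 : (hWeight ω m j : ℂ) * d.seq j = 0 :=
    congrFun (congrArg (fun x : lp (fun _ : ℕ => ℂ) 2 => (x : ℕ → ℂ)) h1) j
  have h3 : hWeight ω m j ≠ 0 := by
    unfold hWeight
    by_cases hj : j = 0
    · subst hj
      rcases Nat.eq_zero_or_pos m with hm | hm
      · subst hm; simp
      · simp [h0, hm.ne']
    · simpa [hj] using fun h => absurd h (hpos j hj).ne'
  exact (mul_eq_zero.mp h2).resolve_left (by exact_mod_cast h3)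

/-- On `h^{2k}_{ω,r}`, the series that defines `‖·‖_{h^{2m}_ω}` converges for every integer
`m ≤ k`, of either sign. -/
theorem summable {k : ℕ} (hω : StrictMono ω) (h0 : ω 0 = 0) (d : HSeq ω k) {m : ℤ}
    (hm : m ≤ k) : Summable (fun j => ‖(hWeight ω m j : ℂ) * d.seq j‖ ^ 2) := by
  have hs : ∀ f : ℕ → ℂ, Memℓp f 2 → Summable (fun j => ‖f j‖ ^ 2) := by
    intro f hf
    simpa using hf.summable (by norm_num)
  have hk := hs _ d.seq_mem.2.2
  rw [← summable_nat_add_iff 1] at hk ⊢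
  have h1 : 0 < ω 1 := h0 ▸ hω one_pos
  refine Summable.of_nonneg_of_le (fun _ => by positivity) (fun j => ?_)
    (hk.mul_left ((ω 1 ^ (m - k)) ^ 2))
  have hj : ω 1 ≤ ω (j + 1) := hω.monotone (by omega)
  have hj0 : 0 < ω (j + 1) := h1.trans_le hj
  have hz : ω (j + 1) ^ (m - k) ≤ ω 1 ^ (m - k) := by
    have e : m - k = -((k - m).toNat : ℤ) := by omega
    rw [e, zpow_neg, zpow_neg, zpow_natCast, zpow_natCast]
    gcongr
  have hw : ω (j + 1) ^ m = ω (j + 1) ^ (m - k) * ω (j + 1) ^ (k : ℤ) := by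
    rw [← zpow_add₀ hj0.ne']
    congr 1
    ring
  rw [← mul_pow]
  gcongr
  simp only [hWeight, Nat.succ_ne_zero, if_false, zero_add, norm_mul, Complex.norm_real,
    Real.norm_eq_abs, abs_of_pos (zpow_pos hj0 _)]
  rw [hw, ← mul_assoc]
  gcongr

end HSeq

/-! ### Sobolev spaces on `(0, T)` -/

/-- Lebesgue measure on `(0, T)`. -/
abbrev μI (T : ℝ) : Measure ℝ := volume.restrict (Ioo 0 T)

/-- The real Hilbert space `L²((0, T), ℝ)`. -/
abbrev L2 (T : ℝ) : Type := Lp ℝ 2 (μI T)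

/-- `φ ∈ C_c^∞((0, T), ℝ)`. -/
structure IsTest (T : ℝ) (φ : ℝ → ℝ) : Prop where
  smooth : ContDiff ℝ ((⊤ : ℕ∞) : WithTop ℕ∞) φ
  compact : HasCompactSupport φ
  supp : tsupport φ ⊆ Ioo 0 T

theorem IsTest.add {T : ℝ} {φ ψ : ℝ → ℝ} (hφ : IsTest T φ) (hψ : IsTest T ψ) :
    IsTest T (φ + ψ) :=
  ⟨hφ.smooth.add hψ.smooth, hφ.compact.add hψ.compact,
    (tsupport_add φ ψ).trans (union_subset hφ.supp hψ.supp)⟩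

theorem IsTest.smul {T : ℝ} {φ : ℝ → ℝ} (r : ℝ) (hφ : IsTest T φ) : IsTest T (r • φ) := by
  have h : r • φ = (fun _ : ℝ => r) • φ := rfl
  refine ⟨hφ.smooth.const_smul r, ?_, ?_⟩
  · rw [h]
    exact hφ.compact.smul_left
  · rw [h]
    exact (tsupport_smul_subset_right (fun _ : ℝ => r) φ).trans hφ.supp

theorem IsTest.zero (T : ℝ) : IsTest T 0 :=
  ⟨contDiff_const, HasCompactSupport.zero, by simp [tsupport]⟩

theorem IsTest.memLp_iteratedDeriv {T : ℝ} {φ : ℝ → ℝ} (hφ : IsTest T φ) (n : ℕ) :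
    MemLp (iteratedDeriv n φ) 2 (μI T) := by
  have hc : Continuous (iteratedDeriv n φ) :=
    hφ.smooth.continuous_iteratedDeriv n (by exact_mod_cast le_top)
  have hs : HasCompactSupport (iteratedDeriv n φ) := by
    induction n with
    | zero => simpa using hφ.compact
    | succ n ih =>
      rw [iteratedDeriv_succ]
      exact (ih (hφ.smooth.continuous_iteratedDeriv n (by exact_mod_cast le_top))).deriv
  exact (hc.memLp_of_hasCompactSupport hs).restrict _

theorem IsTest.integrable_mul {T : ℝ} {φ : ℝ → ℝ} (hφ : IsTest T φ) (n : ℕ) (u : L2 T) :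
    Integrable (fun t => u t * iteratedDeriv n φ t) (μI T) :=
  (Lp.memLp u).integrable_mul (hφ.memLp_iteratedDeriv n)

/-- `v ∈ L²(0, T)` is the `n`-th weak derivative of `u ∈ L²(0, T)` on `(0, T)`. -/
def IsWeakDeriv (T : ℝ) (n : ℕ) (u v : L2 T) : Prop :=
  ∀ φ : ℝ → ℝ, IsTest T φ →
    ∫ t in Ioo 0 T, u t * iteratedDeriv n φ t = (-1) ^ n * ∫ t in Ioo 0 T, v t * φ t

theorem IsWeakDeriv.add {T : ℝ} {n : ℕ} {u v u' v' : L2 T} (h : IsWeakDeriv T n u v)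
    (h' : IsWeakDeriv T n u' v') : IsWeakDeriv T n (u + u') (v + v') := by
  intro φ hφ
  have e1 : ∫ t in Ioo 0 T, (u + u' : L2 T) t * iteratedDeriv n φ t =
      ∫ t in Ioo 0 T, (u t * iteratedDeriv n φ t + u' t * iteratedDeriv n φ t) := by
    apply integral_congr_ae
    filter_upwards [Lp.coeFn_add u u'] with t ht
    rw [ht, Pi.add_apply, add_mul]
  have e2 : ∫ t in Ioo 0 T, (v + v' : L2 T) t * φ t =
      ∫ t in Ioo 0 T, (v t * φ t + v' t * φ t) := by
    apply integral_congr_ae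
    filter_upwards [Lp.coeFn_add v v'] with t ht
    rw [ht, Pi.add_apply, add_mul]
  have i1 := hφ.integrable_mul 0 v
  have i2 := hφ.integrable_mul 0 v'
  rw [iteratedDeriv_zero] at i1 i2
  rw [e1, e2, integral_add (hφ.integrable_mul n u) (hφ.integrable_mul n u'), integral_add i1 i2,
    h φ hφ, h' φ hφ, mul_add]

theorem IsWeakDeriv.smul {T : ℝ} {n : ℕ} {u v : L2 T} (r : ℝ) (h : IsWeakDeriv T n u v) :
    IsWeakDeriv T n (r • u) (r • v) := by
  intro φ hφ
  have e1 : ∫ t in Ioo 0 T, (r • u : L2 T) t * iteratedDeriv n φ t =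
      ∫ t in Ioo 0 T, r * (u t * iteratedDeriv n φ t) := by
    apply integral_congr_ae
    filter_upwards [Lp.coeFn_smul r u] with t ht
    rw [ht, Pi.smul_apply, smul_eq_mul, mul_assoc]
  have e2 : ∫ t in Ioo 0 T, (r • v : L2 T) t * φ t = ∫ t in Ioo 0 T, r * (v t * φ t) := by
    apply integral_congr_ae
    filter_upwards [Lp.coeFn_smul r v] with t ht
    rw [ht, Pi.smul_apply, smul_eq_mul, mul_assoc]
  rw [e1, e2, integral_const_mul, integral_const_mul, h φ hφ]
  ring

theorem IsWeakDeriv.zero (T : ℝ) (n : ℕ) : IsWeakDeriv T n 0 0 := by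
  have h : IsWeakDeriv T n ((0 : ℝ) • (0 : L2 T)) ((0 : ℝ) • (0 : L2 T)) := by
    intro φ hφ
    have e : ∀ ψ : ℝ → ℝ, ∫ t in Ioo 0 T, ((0 : ℝ) • (0 : L2 T) : L2 T) t * ψ t = 0 := by
      intro ψ
      rw [smul_zero]
      apply integral_eq_zero_of_ae
      filter_upwards [Lp.coeFn_zero ℝ 2 (μI T)] with t ht
      rw [ht]
      simp
    rw [e, e, mul_zero]
  simpa using h

/-- The Sobolev space `H^k((0, T), ℝ)`. An element is the tuple `(u, u', …, u^{(k)})` of an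
`L²` function and its weak derivatives of order at most `k`, all in `L²` (they are determined by
`u`). The norm, inherited from the `ℓ²`-sum of `k + 1` copies of `L²`, is the usual one,
`(∑_{n ≤ k} ‖u^{(n)}‖²_{L²})^{1/2}`. -/
def SobolevH (k : ℕ) (T : ℝ) : Submodule ℝ (PiLp 2 (fun _ : Fin (k + 1) => L2 T)) where
  carrier := {U | ∀ n : Fin (k + 1), IsWeakDeriv T n (U 0) (U n)}
  zero_mem' := fun n => IsWeakDeriv.zero T n
  add_mem' := fun ha hb n => (ha n).add (hb n)
  smul_mem' := fun r _ ha n => (ha n).smul r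

/-- The elements of `H^k(0, T)` that are (almost everywhere equal to) test functions. -/
def testSubmodule (k : ℕ) (T : ℝ) : Submodule ℝ (SobolevH k T) where
  carrier := {U | ∃ φ : ℝ → ℝ, IsTest T φ ∧ U.1 0 =ᵐ[μI T] φ}
  zero_mem' := ⟨0, IsTest.zero T, Lp.coeFn_zero ℝ 2 (μI T)⟩
  add_mem' := by
    rintro a b ⟨φ, hφ, ha⟩ ⟨ψ, hψ, hb⟩
    exact ⟨φ + ψ, hφ.add hψ, (Lp.coeFn_add (a.1 0) (b.1 0)).trans (ha.add hb)⟩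
  smul_mem' := by
    rintro r a ⟨φ, hφ, ha⟩
    refine ⟨r • φ, hφ.smul r, (Lp.coeFn_smul r (a.1 0)).trans ?_⟩
    filter_upwards [ha] with t ht
    simp [ht]

/-- `H^k_0((0, T), ℝ)`: the closure of `C_c^∞(0, T)` in `H^k(0, T)`. Its topology is that of the
`H^k` norm or, equivalently by the Poincaré inequality, of the norm `‖u^{(k)}‖_{L²}`. -/
def SobolevH0 (k : ℕ) (T : ℝ) : Submodule ℝ (SobolevH k T) :=
  (testSubmodule k T).topologicalClosure

/-- The weak derivative `u^{(n)} ∈ L²(0, T)`, `0 ≤ n ≤ k`, of `u ∈ H^k_0(0, T)`. For `n = 0` this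
is `u` itself. -/
def SobolevH0.wderiv {k : ℕ} {T : ℝ} (u : SobolevH0 k T) (n : Fin (k + 1)) : L2 T := u.1.1 n

/-- The function `u : (0, T) → ℝ` underlying an element of `H^k_0(0, T)`. -/
def SobolevH0.toFun {k : ℕ} {T : ℝ} (u : SobolevH0 k T) : ℝ → ℝ := SobolevH0.wderiv u 0

/-- For `0 ≤ m ≤ k`, the norm `‖u‖_{H^m_0(0, T)} = (∫₀ᵀ u^{(m)}(t)² dt)^{1/2}`. -/
def SobolevH0.posNorm {k : ℕ} {T : ℝ} (u : SobolevH0 k T) (m : Fin (k + 1)) : ℝ :=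
  ‖SobolevH0.wderiv u m‖

/-! ### Iterated primitives and negative norms -/

/-- The iterated primitives `u_0 = u`, `u_{n+1}(t) = ∫₀ᵗ u_n(τ) dτ`. -/
def iterPrim (u : ℝ → ℝ) : ℕ → ℝ → ℝ
  | 0 => u
  | n + 1 => fun t => ∫ τ in (0 : ℝ)..t, iterPrim u n τ

/-- For `n ≥ 1`, the norm `‖u‖_{H^{-n}(0, T)} = |u_1(T)| + ‖u_n‖_{L²(0, T)}`. -/
def negNorm (T : ℝ) (n : ℕ) (u : ℝ → ℝ) : ℝ :=
  |iterPrim u 1 T| + Real.sqrt (∫ t in (0 : ℝ)..T, (iterPrim u n t) ^ 2)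

end MomentProblem

end

noncomputable section

namespace MomentProblem

open Filter Topology

/-! ### Infinite matrices on `ℓ²` and Bessel families -/

section Matrix

variable {ι : Type*} [DecidableEq ι]

/-! Fix a real test function `σ` with `∫ σ² = 1`, put `ρ = σ²`, and let `λ` run over the frequencies
`±ω_{j+1}`. For a combination `∑ a_i ρ(t) e^{-iλ_i t}`, the moment at `λ_l` is `∑ ρ̂(λ_l - λ_i)
a_i`, so the moment problem becomes a linear system whose matrix is the Gram matrix of the functions
`σ e^{-iλ_i t}`. Its diagonal is `1`. Off the diagonal, `ρ̂` decays faster than any power while the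
gaps grow polynomially (`sparseFreq_twoSided`), so the entries are absolutely summable, even after
conjugation by `λ^q`. The system is therefore identity plus compact on each weighted `ℓ²`, and it is
invertible as soon as it is injective.

Injectivity (`SparseFreq.gram_injective`) holds for every `T > 0`, because the kernel is stable
under multiplication by `λ`. If `x` is in the kernel then `∑ x_i σ e^{-iλ_i t} = 0`, and pairing
this with modulations of `2σ'` produces the commutator of the Gram matrix with `λ`, since `(σ²)' =
2σ'σ`. A kernel element is also controlled by finitely many of its coordinates. Multiplying by
polynomials in `λ` that vanish at these frequencies, or at all of them but one, kills every
coordinate.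

The inverses for different weights agree where they are all defined, so one solution satisfies the
estimates of all orders (`SparseFreq.exists_solver`). The problem is solved for the data
`(-iλ)^{-(k+1)} d`, and the solution `χ` is differentiated `k + 1` times. Then `u = χ^{(k+1)}` has
moments `d`, its iterated primitives are the lower derivatives of `χ`, which vanish at `T`, and an
estimate of order `q` on `χ` is one of order `q - (k+1)` on `u`. Conjugate data at `-ω_j` allow the
real part to be taken (`exists_solution_operator`).

This `u` has zero mean, so `d_0` is treated apart. A test function `w` of mean `1` whose further
primitives vanish at `T` (`exists_profile`) is corrected by the solution for its own nonzero
moments, and `d_0` times the result is added. -/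

/-- The complex Hilbert space `ℓ²(ι, ℂ)`. -/
abbrev Ell2 (ι : Type*) : Type _ := lp (fun _ : ι => ℂ) 2

/-- The rank one operator `x ↦ x_j δ_i`. -/
def unitOp (i j : ι) : Ell2 ι →L[ℂ] Ell2 ι :=
  (lp.singleContinuousLinearMap ℂ (fun _ : ι => ℂ) 2 i).comp (lp.evalCLM ℂ (fun _ : ι => ℂ) 2 j)

theorem unitOp_apply (i j : ι) (x : Ell2 ι) : unitOp i j x = lp.single 2 i (x j) := rfl

theorem norm_unitOp_le (i j : ι) : ‖unitOp i j‖ ≤ 1 := by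
  refine ContinuousLinearMap.opNorm_le_bound _ zero_le_one fun x => ?_
  rw [unitOp_apply, lp.norm_single (by norm_num), one_mul]
  exact lp.norm_apply_le_norm (by norm_num) x j

theorem isCompactOperator_unitOp (i j : ι) : IsCompactOperator (unitOp i j) :=
  (isCompactOperator_of_locallyCompactSpace_rng
    (lp.singleContinuousLinearMap ℂ (fun _ : ι => ℂ) 2 i)).comp_clm
    (lp.evalCLM ℂ (fun _ : ι => ℂ) 2 j)

/-- The operator on `ℓ²` with the absolutely summable matrix `A`. -/
def matOp (A : ι → ι → ℂ) : Ell2 ι →L[ℂ] Ell2 ι :=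
  ∑' p : ι × ι, A p.1 p.2 • unitOp p.1 p.2

theorem hasSum_matOp {A : ι → ι → ℂ} (hA : Summable fun p : ι × ι => ‖A p.1 p.2‖) :
    HasSum (fun p : ι × ι => A p.1 p.2 • unitOp p.1 p.2) (matOp A) := by
  refine (Summable.of_norm_bounded hA fun p => ?_).hasSum
  rw [norm_smul]
  exact mul_le_of_le_one_right (norm_nonneg _) (norm_unitOp_le _ _)

/-- Absolute summability makes the series of rank one operators converge in operator norm, and
compact operators are closed for that norm. -/
theorem isCompactOperator_matOp {A : ι → ι → ℂ} (hA : Summable fun p : ι × ι => ‖A p.1 p.2‖) :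
    IsCompactOperator (matOp A) := by
  refine isCompactOperator_of_tendsto (hasSum_matOp hA) (Eventually.of_forall fun s => ?_)
  change (∑ p ∈ s, A p.1 p.2 • unitOp p.1 p.2) ∈ compactOperator (RingHom.id ℂ) (Ell2 ι) (Ell2 ι)
  exact Submodule.sum_mem _ fun p _ => Submodule.smul_mem _ _ (isCompactOperator_unitOp p.1 p.2)

omit [DecidableEq ι] in
theorem summable_row {A : ι → ι → ℂ} (hA : Summable fun p : ι × ι => ‖A p.1 p.2‖) (x : Ell2 ι)
    (l : ι) : Summable fun j => A l j * x j := by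
  refine Summable.of_norm_bounded ((hA.prod_factor l).mul_right ‖x‖) fun j => ?_
  rw [norm_mul]
  exact mul_le_mul_of_nonneg_left (lp.norm_apply_le_norm (by norm_num) x j) (norm_nonneg _)

theorem matOp_apply {A : ι → ι → ℂ} (hA : Summable fun p : ι × ι => ‖A p.1 p.2‖) (x : Ell2 ι)
    (l : ι) : matOp A x l = ∑' j, A l j * x j := by
  let ev : (Ell2 ι →L[ℂ] Ell2 ι) →L[ℂ] ℂ :=
    (lp.evalCLM ℂ (fun _ : ι => ℂ) 2 l).comp (ContinuousLinearMap.apply ℂ (Ell2 ι) x)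
  have h := (hasSum_matOp hA).mapL ev
  have e : ∀ p : ι × ι, ev (A p.1 p.2 • unitOp p.1 p.2) =
      if p.1 = l then A l p.2 * x p.2 else 0 := by
    intro p
    change (A p.1 p.2 • lp.single 2 p.1 (x p.2) : Ell2 ι) l = _
    rw [lp.coeFn_smul, Pi.smul_apply, lp.single_apply, smul_eq_mul]
    by_cases hp : p.1 = l
    · subst hp; simp
    · rw [Pi.single_eq_of_ne (Ne.symm hp), if_neg hp, mul_zero]
  simp only [e] at h
  have h2 : HasSum (fun j => A l j * x j) (matOp A x l) := by
    have hi : Function.Injective (fun j : ι => (l, j)) := fun a b hab => (Prod.ext_iff.mp hab).2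
    rw [← hi.hasSum_iff] at h
    · simpa [Function.comp_def] using! h
    · rintro ⟨i, j⟩ hij
      rw [if_neg]
      rintro rfl
      exact hij ⟨j, rfl⟩
  exact h2.tsum_eq.symm

/-- Fredholm alternative for `1 + A`, `A` an absolutely summable matrix. -/
theorem exists_inverse_one_add_matOp {A : ι → ι → ℂ}
    (hA : Summable fun p : ι × ι => ‖A p.1 p.2‖) (hinj : ∀ x : Ell2 ι, x + matOp A x = 0 → x = 0) :
    ∃ R : Ell2 ι →L[ℂ] Ell2 ι, (∀ y, R y + matOp A (R y) = y) ∧ ∀ x, R (x + matOp A x) = x := by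
  rcases (isCompactOperator_matOp hA).hasEigenvalue_or_mem_resolventSet
    (μ := (-1 : ℂ)) (by norm_num) with h | h
  · exfalso
    obtain ⟨x, hx⟩ := h.exists_hasEigenvector
    apply hx.2
    apply hinj
    have := hx.apply_eq_smul
    change matOp A x = _ at this
    rw [this]; simp
  · rw [spectrum.mem_resolventSet_iff] at h
    obtain ⟨u, hu⟩ := h
    -- The unit given by the resolvent is `-1 - A`; hence the sign in the inverse chosen below.
    have e : ∀ x, (u : Ell2 ι →L[ℂ] Ell2 ι) x = -(x + matOp A x) := by
      intro x
      rw [hu, Algebra.algebraMap_eq_smul_one]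
      simp
      abel
    refine ⟨-((u⁻¹ : (Ell2 ι →L[ℂ] Ell2 ι)ˣ) : Ell2 ι →L[ℂ] Ell2 ι), fun y => ?_, fun x => ?_⟩
    · have := congrArg (fun f : Ell2 ι →L[ℂ] Ell2 ι => f y) u.mul_inv
      rw [← neg_neg (_ + matOp A _), ← e, neg_apply, map_neg, neg_neg]
      exact this
    · have := congrArg (fun f : Ell2 ι →L[ℂ] Ell2 ι => f x) u.inv_mul
      rw [← neg_neg (x + matOp A x), ← e, neg_apply, map_neg, neg_neg]
      exact this

omit [DecidableEq ι] in
/-- Diagonal operators with bounded coefficients. -/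
theorem exists_diagonal {c : ι → ℂ} {B : ℝ} (hc : ∀ i, ‖c i‖ ≤ B) :
    ∃ D : Ell2 ι →L[ℂ] Ell2 ι, ∀ x i, D x i = c i * x i := by
  have hle : ∀ (x : Ell2 ι) i, ‖c i * x i‖ ≤ ‖(|B| • x : Ell2 ι) i‖ := by
    intro x i
    rw [lp.coeFn_smul, Pi.smul_apply, norm_mul, norm_smul, Real.norm_eq_abs, abs_abs]
    exact mul_le_mul_of_nonneg_right ((hc i).trans (le_abs_self B)) (norm_nonneg _)
  have hmem : ∀ x : Ell2 ι, Memℓp (fun i => c i * x i) 2 := fun x =>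
    (lp.memℓp (|B| • x : Ell2 ι)).mono' (hle x)
  let D₀ : Ell2 ι →ₗ[ℂ] Ell2 ι :=
    { toFun := fun x => ⟨fun i => c i * x i, hmem x⟩
      map_add' := fun x y => by
        ext i
        exact mul_add _ _ _
      map_smul' := fun a x => by
        ext i
        exact mul_left_comm _ _ _ }
  refine ⟨D₀.mkContinuous |B| fun x => ?_, fun x i => rfl⟩
  refine (lp.norm_mono (by norm_num) (hle x)).trans_eq ?_
  rw [norm_smul, Real.norm_eq_abs, abs_abs]

end Matrix

/-! ### Bessel families and their synthesis operators -/

section Bessel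

variable {ι : Type*} {H : Type*} [NormedAddCommGroup H] [InnerProductSpace ℂ H]

/-- A family whose synthesis map `x ↦ ∑ x_i g_i` is bounded on `ℓ²`. -/
def IsBessel (g : ι → H) : Prop :=
  ∃ C : ℝ, 0 ≤ C ∧ ∀ (s : Finset ι) (x : ι → ℂ), ‖∑ i ∈ s, x i • g i‖ ^ 2 ≤ C * ∑ i ∈ s, ‖x i‖ ^ 2

theorem IsBessel.add {g h : ι → H} (hg : IsBessel g) (hh : IsBessel h) :
    IsBessel fun i => g i + h i := by
  obtain ⟨C, hC, hg⟩ := hg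
  obtain ⟨D, hD, hh⟩ := hh
  refine ⟨2 * (C + D), by positivity, fun s x => ?_⟩
  simp only [smul_add, Finset.sum_add_distrib]
  have h1 := hg s x
  have h2 := hh s x
  set a := ∑ i ∈ s, x i • g i
  set b := ∑ i ∈ s, x i • h i
  have h3 : ‖a + b‖ ^ 2 ≤ (‖a‖ + ‖b‖) ^ 2 := by gcongr; exact norm_add_le _ _
  nlinarith [sq_nonneg (‖a‖ - ‖b‖)]

theorem IsBessel.smul {g : ι → H} (hg : IsBessel g) {c : ι → ℂ} {B : ℝ} (hc : ∀ i, ‖c i‖ ≤ B) :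
    IsBessel fun i => c i • g i := by
  obtain ⟨C, hC, hg⟩ := hg
  refine ⟨C * B ^ 2, by positivity, fun s x => ?_⟩
  have h := hg s fun i => x i * c i
  simp only [smul_smul]
  refine h.trans ?_
  rw [mul_assoc]
  gcongr
  rw [Finset.mul_sum]
  refine Finset.sum_le_sum fun i _ => ?_
  rw [norm_mul, mul_pow, mul_comm]
  gcongr
  exact hc i

/-- A family with bounded norms and absolutely summable off-diagonal Gram matrix is Bessel. -/
theorem isBessel_of_gram [DecidableEq ι] {g : ι → H} {B : ℝ} (hB : ∀ i, ‖g i‖ ^ 2 ≤ B)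
    (hg : Summable fun p : ι × ι => if p.1 = p.2 then 0 else ‖inner ℂ (g p.1) (g p.2)‖) :
    IsBessel g := by
  set F : ι × ι → ℝ := fun p => if p.1 = p.2 then 0 else ‖inner ℂ (g p.1) (g p.2)‖ with hF
  have hF0 : ∀ p, 0 ≤ F p := by intro p; simp only [hF]; split_ifs <;> positivity
  refine ⟨|B| + ∑' p, F p, add_nonneg (abs_nonneg _) (tsum_nonneg hF0), fun s x => ?_⟩
  have hx : ∀ i ∈ s, ‖x i‖ ^ 2 ≤ ∑ i ∈ s, ‖x i‖ ^ 2 := fun i hi =>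
    Finset.single_le_sum (f := fun i => ‖x i‖ ^ 2) (fun _ _ => by positivity) hi
  set X := ∑ i ∈ s, ‖x i‖ ^ 2 with hX
  have hX0 : 0 ≤ X := Finset.sum_nonneg fun _ _ => by positivity
  -- Off the diagonal, `‖x i‖ ‖x j‖ ≤ X` is crude but enough, because the Gram entries are summable
  -- over all pairs.
  have key : ∀ i ∈ s, ∀ j ∈ s, ‖inner ℂ (x i • g i) (x j • g j)‖ ≤
      (if i = j then |B| * ‖x i‖ ^ 2 else 0) + F (i, j) * X := by
    intro i hi j hj
    rw [inner_smul_left, inner_smul_right, norm_mul, norm_mul, RCLike.norm_conj]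
    by_cases hij : i = j
    · subst hij
      have : ‖inner ℂ (g i) (g i)‖ ≤ |B| := by
        rw [inner_self_eq_norm_sq_to_K]
        simpa using (hB i).trans (le_abs_self B)
      simp only [if_true, hF, zero_mul, add_zero]
      nlinarith [mul_le_mul_of_nonneg_left this (sq_nonneg ‖x i‖)]
    · simp only [hF, if_neg hij, zero_add]
      have h1 := hx i hi
      have h2 := hx j hj
      have h3 : ‖x i‖ * ‖x j‖ ≤ X := by nlinarith [sq_nonneg (‖x i‖ - ‖x j‖)]
      nlinarith [mul_le_mul_of_nonneg_right h3 (norm_nonneg (inner ℂ (g i) (g j)))]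
  have h1 : ‖∑ i ∈ s, x i • g i‖ ^ 2 ≤ ∑ i ∈ s, ∑ j ∈ s, ‖inner ℂ (x i • g i) (x j • g j)‖ := by
    have e : (‖∑ i ∈ s, x i • g i‖ : ℝ) ^ 2 =
        ‖inner ℂ (∑ i ∈ s, x i • g i) (∑ i ∈ s, x i • g i)‖ := by
      rw [inner_self_eq_norm_sq_to_K]; simp
    rw [e, sum_inner]
    refine (norm_sum_le _ _).trans (Finset.sum_le_sum fun i _ => ?_)
    rw [inner_sum]
    exact norm_sum_le _ _
  refine h1.trans ((Finset.sum_le_sum fun i hi => Finset.sum_le_sum fun j hj =>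
    key i hi j hj).trans ?_)
  simp only [Finset.sum_add_distrib, add_mul]
  gcongr
  · rw [hX, Finset.mul_sum]
    refine Finset.sum_le_sum fun i hi => ?_
    rw [Finset.sum_ite_eq, if_pos hi]
  · simp only [← Finset.sum_mul]
    gcongr
    rw [← Finset.sum_product']
    exact hg.sum_le_tsum _ fun p _ => hF0 p

/-- The synthesis operator of a Bessel family. -/
theorem IsBessel.exists_synthesis [CompleteSpace H] {g : ι → H} (hg : IsBessel g) :
    ∃ S : Ell2 ι →L[ℂ] H, ∀ x : Ell2 ι, HasSum (fun i => x i • g i) (S x) := by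
  obtain ⟨C, hC, hg⟩ := hg
  have hx2 : ∀ x : Ell2 ι, HasSum (fun i => ‖x i‖ ^ 2) (‖x‖ ^ 2) := by
    intro x
    have := lp.hasSum_norm (p := 2) (by norm_num) x
    simpa using this
  have hs : ∀ x : Ell2 ι, Summable fun i => x i • g i := by
    intro x
    rw [summable_iff_vanishing_norm]
    intro ε hε
    obtain ⟨s, hs⟩ := summable_iff_vanishing_norm.mp (hx2 x).summable (ε ^ 2 / (C + 1))
      (by positivity)
    refine ⟨s, fun t ht => ?_⟩
    have h1 := hs t ht
    rw [Real.norm_of_nonneg (Finset.sum_nonneg fun _ _ => by positivity),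
      lt_div_iff₀ (by positivity)] at h1
    have h2 := hg t x
    have h3 : 0 ≤ ∑ i ∈ t, ‖x i‖ ^ 2 := Finset.sum_nonneg fun _ _ => by positivity
    refine lt_of_pow_lt_pow_left₀ 2 hε.le ?_
    nlinarith
  let S₀ : Ell2 ι →ₗ[ℂ] H :=
    { toFun := fun x => ∑' i, x i • g i
      map_add' := fun x y => by
        rw [← (hs x).tsum_add (hs y)]
        exact tsum_congr fun i => add_smul _ _ _
      map_smul' := fun c x => by
        rw [RingHom.id_apply, ← (hs x).tsum_const_smul]
        exact tsum_congr fun i => mul_smul c (x i) (g i) }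
  refine ⟨S₀.mkContinuous (Real.sqrt C) fun x => ?_, fun x => (hs x).hasSum⟩
  have h1 : Tendsto (fun s : Finset ι => ‖∑ i ∈ s, x i • g i‖ ^ 2) atTop (𝓝 (‖S₀ x‖ ^ 2)) :=
    ((hs x).hasSum.norm).pow 2
  have h2 : ‖S₀ x‖ ^ 2 ≤ C * ‖x‖ ^ 2 := by
    refine le_of_tendsto h1 (Eventually.of_forall fun s => (hg s x).trans ?_)
    gcongr
    exact sum_le_hasSum s (fun _ _ => by positivity) (hx2 x)
  refine (pow_le_pow_iff_left₀ (norm_nonneg _) (by positivity) two_ne_zero).mp ?_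
  rw [mul_pow, Real.sq_sqrt hC]
  exact h2

end Bessel

/-! ### Complex test functions and their Fourier transform -/

/-- `g ∈ C_c^∞((0, T), ℂ)`. -/
structure CTest (T : ℝ) (g : ℝ → ℂ) : Prop where
  smooth : ContDiff ℝ ((⊤ : ℕ∞) : WithTop ℕ∞) g
  supp : tsupport g ⊆ Ioo 0 T

namespace CTest

variable {T : ℝ} {g h : ℝ → ℂ}

theorem hasCompactSupport (hg : CTest T g) : HasCompactSupport g :=
  isCompact_Icc.of_isClosed_subset (isClosed_tsupport g) (hg.supp.trans Ioo_subset_Icc_self)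

theorem eq_zero (hg : CTest T g) {t : ℝ} (ht : t ∉ Ioo 0 T) : g t = 0 :=
  image_eq_zero_of_notMem_tsupport fun h => ht (hg.supp h)

theorem continuous (hg : CTest T g) : Continuous g := hg.smooth.continuous

theorem mul (hg : CTest T g) (hh : ContDiff ℝ ((⊤ : ℕ∞) : WithTop ℕ∞) h) :
    CTest T fun t => g t * h t :=
  ⟨hg.smooth.mul hh, (tsupport_mul_subset_left (f := g) (g := h)).trans hg.supp⟩

theorem add (hg : CTest T g) (hh : CTest T h) : CTest T fun t => g t + h t :=
  ⟨hg.smooth.add hh.smooth, (tsupport_add g h).trans (union_subset hg.supp hh.supp)⟩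

theorem deriv (hg : CTest T g) : CTest T (deriv g) :=
  ⟨((contDiff_infty_iff_deriv (f := g)).mp hg.smooth).2,
    (tsupport_deriv_subset (f := g)).trans hg.supp⟩

theorem iteratedDeriv (hg : CTest T g) (n : ℕ) : CTest T (iteratedDeriv n g) := by
  induction n with
  | zero => simpa using hg
  | succ n ih =>
    rw [iteratedDeriv_succ]
    exact ih.deriv

theorem conj (hg : CTest T g) : CTest T fun t => (starRingEnd ℂ) (g t) := by
  refine ⟨Complex.conjCLE.contDiff.comp hg.smooth, ?_⟩
  refine (tsupport_comp_subset (g := fun z : ℂ => (starRingEnd ℂ) z) (map_zero _) g).trans hg.supp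

theorem re (hg : CTest T g) : IsTest T fun t => (g t).re := by
  have h : tsupport (fun t => (g t).re) ⊆ tsupport g :=
    tsupport_comp_subset (g := Complex.re) Complex.zero_re g
  exact ⟨Complex.reCLM.contDiff.comp hg.smooth,
    hg.hasCompactSupport.of_isClosed_subset (isClosed_tsupport _) h, h.trans hg.supp⟩

theorem hasDerivAt (hg : CTest T g) (t : ℝ) : HasDerivAt g (_root_.deriv g t) t :=
  (hg.smooth.differentiable (by simp)).differentiableAt.hasDerivAt

theorem iteratedDeriv_re (hg : CTest T g) (n : ℕ) :
    _root_.iteratedDeriv n (fun t => (g t).re) = fun t => (_root_.iteratedDeriv n g t).re := by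
  induction n with
  | zero => simp
  | succ n ih =>
    rw [iteratedDeriv_succ, ih, iteratedDeriv_succ]
    funext t
    have := ((hg.iteratedDeriv n).hasDerivAt t)
    exact (Complex.reCLM.hasFDerivAt.comp_hasDerivAt t this).deriv

theorem memLp (hg : CTest T g) (p : ℝ≥0∞) : MemLp g p (μI T) :=
  (hg.continuous.memLp_of_hasCompactSupport hg.hasCompactSupport).restrict _

/-- The class in `L²((0, T), ℂ)`. -/
def toL2 (hg : CTest T g) : Lp ℂ 2 (μI T) := (hg.memLp 2).toLp g

theorem coeFn_toL2 (hg : CTest T g) : hg.toL2 =ᵐ[μI T] g := (hg.memLp 2).coeFn_toLp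

theorem inner_toL2 (hg : CTest T g) (hh : CTest T h) :
    inner ℂ hg.toL2 hh.toL2 = ∫ t in Ioo 0 T, (starRingEnd ℂ) (g t) * h t := by
  rw [L2.inner_def]
  apply integral_congr_ae
  filter_upwards [hg.coeFn_toL2, hh.coeFn_toL2] with t h1 h2
  rw [h1, h2, RCLike.inner_apply, mul_comm]

end CTest

/-- `∫₀ᵀ g(t) e^{ixt} dt`. -/
def hat (T : ℝ) (g : ℝ → ℂ) (x : ℝ) : ℂ :=
  ∫ t in Ioo 0 T, g t * Complex.exp (Complex.I * x * t)

theorem norm_exp_I_mul_mul (x t : ℝ) : ‖Complex.exp (Complex.I * x * t)‖ = 1 := by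
  rw [show Complex.I * x * t = ((x * t : ℝ) : ℂ) * Complex.I by push_cast; ring]
  exact Complex.norm_exp_ofReal_mul_I _

theorem contDiff_exp_I (x : ℝ) :
    ContDiff ℝ ((⊤ : ℕ∞) : WithTop ℕ∞) fun t : ℝ => Complex.exp (Complex.I * x * t) :=
  (contDiff_const.mul Complex.ofRealCLM.contDiff).cexp

theorem hasDerivAt_exp_I (x t : ℝ) : HasDerivAt (fun t : ℝ => Complex.exp (Complex.I * x * t))
    (Complex.exp (Complex.I * x * t) * (Complex.I * x)) t := by
  have : HasDerivAt (fun t : ℝ => Complex.I * x * (t : ℂ)) (Complex.I * x) t := by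
    simpa using (Complex.ofRealCLM.hasDerivAt (x := t)).const_mul (Complex.I * (x : ℂ))
  exact this.cexp

theorem CTest.integral_deriv {T : ℝ} (hT : 0 ≤ T) {g : ℝ → ℂ} (hg : CTest T g) :
    ∫ t in Ioo 0 T, _root_.deriv g t = 0 := by
  rw [← integral_Ioc_eq_integral_Ioo, ← intervalIntegral.integral_of_le hT,
    intervalIntegral.integral_eq_sub_of_hasDerivAt (fun t _ => hg.hasDerivAt t)
      (hg.deriv.continuous.intervalIntegrable _ _),
    hg.eq_zero (by simp), hg.eq_zero (by simp), sub_zero]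

/-- Integration by parts, with no boundary term because the support is compact in `(0, T)`. -/
theorem hat_deriv {T : ℝ} (hT : 0 ≤ T) {g : ℝ → ℂ} (hg : CTest T g) (x : ℝ) :
    hat T (deriv g) x = -(Complex.I * x) * hat T g x := by
  have h1 := (hg.mul (contDiff_exp_I x)).integral_deriv hT
  have e : ∀ t, deriv (fun t => g t * Complex.exp (Complex.I * x * t)) t =
      deriv g t * Complex.exp (Complex.I * x * t) +
        (Complex.I * x) * (g t * Complex.exp (Complex.I * x * t)) := by
    intro t
    rw [((hg.hasDerivAt t).fun_mul (hasDerivAt_exp_I x t)).deriv]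
    ring
  simp only [e] at h1
  rw [integral_add, integral_const_mul] at h1
  · rw [hat, hat]
    linear_combination h1
  · exact memLp_one_iff_integrable.mp ((hg.deriv.mul (contDiff_exp_I x)).memLp 1)
  · exact (memLp_one_iff_integrable.mp ((hg.mul (contDiff_exp_I x)).memLp 1)).const_mul _

theorem hat_iteratedDeriv {T : ℝ} (hT : 0 ≤ T) {g : ℝ → ℂ} (hg : CTest T g) (n : ℕ) (x : ℝ) :
    hat T (iteratedDeriv n g) x = (-(Complex.I * x)) ^ n * hat T g x := by
  induction n with
  | zero => simp
  | succ n ih =>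
    rw [iteratedDeriv_succ, hat_deriv hT (hg.iteratedDeriv n), ih]
    ring

theorem norm_hat_le (T : ℝ) (g : ℝ → ℂ) (x : ℝ) : ‖hat T g x‖ ≤ ∫ t in Ioo 0 T, ‖g t‖ := by
  refine (norm_integral_le_integral_norm _).trans_eq ?_
  simp only [norm_mul, norm_exp_I_mul_mul, mul_one]

/-- The Fourier transform of a test function is rapidly decreasing. -/
theorem CTest.hat_decay {T : ℝ} (hT : 0 ≤ T) {g : ℝ → ℂ} (hg : CTest T g) (n : ℕ) :
    ∃ C : ℝ, 0 ≤ C ∧ ∀ x : ℝ, (1 + |x|) ^ n * ‖hat T g x‖ ≤ C := by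
  have h0 := norm_hat_le T g
  have hn := norm_hat_le T (_root_.iteratedDeriv n g)
  simp only [hat_iteratedDeriv hT hg, norm_mul, norm_pow, norm_neg, Complex.norm_I, one_mul,
    Complex.norm_real, Real.norm_eq_abs] at hn
  set A := ∫ t in Ioo 0 T, ‖g t‖
  set B := ∫ t in Ioo 0 T, ‖_root_.iteratedDeriv n g t‖
  have hA : 0 ≤ A := (norm_nonneg _).trans (h0 0)
  have hB : 0 ≤ B := le_trans (by positivity) (hn 0)
  refine ⟨2 ^ (n - 1) * (A + B), by positivity, fun x => ?_⟩
  calc (1 + |x|) ^ n * ‖hat T g x‖ ≤ (2 ^ (n - 1) * (1 ^ n + |x| ^ n)) * ‖hat T g x‖ := by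
        gcongr
        exact add_pow_le zero_le_one (abs_nonneg x) n
    _ = 2 ^ (n - 1) * (‖hat T g x‖ + |x| ^ n * ‖hat T g x‖) := by ring
    _ ≤ _ := by
        gcongr
        · exact h0 x
        · exact hn x

/-! ### Modulated profiles -/

/-- The modulated profile `ρ(t) e^{-ixt}`. -/
def mode (ρ : ℝ → ℂ) (x : ℝ) : ℝ → ℂ := fun t => ρ t * Complex.exp (Complex.I * (-x : ℝ) * t)

theorem CTest.mode {T : ℝ} {ρ : ℝ → ℂ} (hρ : CTest T ρ) (x : ℝ) : CTest T (mode ρ x) :=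
  hρ.mul (contDiff_exp_I (-x))

theorem hat_mode (T : ℝ) (ρ : ℝ → ℂ) (x y : ℝ) : hat T (mode ρ x) y = hat T ρ (y - x) := by
  unfold hat mode
  congr 1
  funext t
  rw [mul_assoc, ← Complex.exp_add]
  congr 2
  push_cast
  ring

theorem deriv_mode {T : ℝ} {ρ : ℝ → ℂ} (hρ : CTest T ρ) (x : ℝ) :
    deriv (mode ρ x) = fun t => mode (deriv ρ) x t + (-(Complex.I * x)) * mode ρ x t := by
  funext t
  have := ((hρ.hasDerivAt t).fun_mul (hasDerivAt_exp_I (-x) t)).deriv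
  unfold mode
  rw [this]
  push_cast
  ring

/-- The innermost derivative falls either on the profile or on the exponential, so each order of
differentiation costs at most one factor of the frequency. -/
theorem iteratedDeriv_succ_mode {T : ℝ} {ρ : ℝ → ℂ} (hρ : CTest T ρ) (x : ℝ) (m : ℕ) :
    iteratedDeriv (m + 1) (mode ρ x) = fun t => iteratedDeriv m (mode (deriv ρ) x) t +
      (-(Complex.I * x)) * iteratedDeriv m (mode ρ x) t := by
  rw [iteratedDeriv_succ', deriv_mode hρ]
  funext t
  have h1 : ContDiffAt ℝ m (mode (deriv ρ) x) t :=
    ((hρ.deriv.mode x).smooth.of_le (by exact_mod_cast le_top)).contDiffAt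
  have h2 : ContDiffAt ℝ m (mode ρ x) t :=
    ((hρ.mode x).smooth.of_le (by exact_mod_cast le_top)).contDiffAt
  rw [iteratedDeriv_fun_add h1 (contDiffAt_const.mul h2), iteratedDeriv_const_mul_field]

/-- This is the link between Gram matrices and moments: for real `σ`, the Gram matrix of the modes
of `σ` is the moment matrix of the modes of `σ²`. -/
theorem inner_mode {T : ℝ} {ρ θ : ℝ → ℂ} (hρ : CTest T ρ) (hθ : CTest T θ) (x y : ℝ) :
    inner ℂ (hρ.mode x).toL2 (hθ.mode y).toL2 =
      hat T (fun t => (starRingEnd ℂ) (ρ t) * θ t) (x - y) := by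
  rw [CTest.inner_toL2, hat]
  congr 1
  funext t
  unfold mode
  rw [map_mul, ← Complex.exp_conj]
  simp only [map_mul, Complex.conj_I, Complex.conj_ofReal]
  rw [mul_mul_mul_comm, ← Complex.exp_add]
  congr 2
  push_cast
  ring

/-! ### Sparse frequencies -/

section Sparse

variable {ι : Type*} [DecidableEq ι]

/-- Distinct frequencies, bounded away from `0`, with `∑_{i ≠ j} |λ_i - λ_j|^{-M} < ∞` for some
`M`. -/
structure SparseFreq (lam : ι → ℝ) : Prop where
  inj : Function.Injective lam
  pos : ∃ δ : ℝ, 0 < δ ∧ ∀ i, δ ≤ |lam i|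
  sum : ∃ M : ℕ, Summable fun p : ι × ι =>
    if p.1 = p.2 then 0 else (|lam p.1 - lam p.2|⁻¹) ^ M

variable {lam : ι → ℝ} {T : ℝ}

theorem SparseFreq.ne_zero (h : SparseFreq lam) (i : ι) : lam i ≠ 0 := by
  obtain ⟨δ, hδ, h⟩ := h.pos
  exact abs_pos.mp (hδ.trans_le (h i))

theorem SparseFreq.summable_hat (h : SparseFreq lam) (hT : 0 ≤ T) {g : ℝ → ℂ} (hg : CTest T g)
    (q : ℕ) : Summable fun p : ι × ι => if p.1 = p.2 then 0 else
      (1 + |lam p.1 - lam p.2|) ^ q * ‖hat T g (lam p.1 - lam p.2)‖ := by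
  obtain ⟨M, hM⟩ := h.sum
  -- Of the `q + M` powers of decay, `q` absorb the polynomial factor and `M` give summability.
  obtain ⟨C, hC, hd⟩ := hg.hat_decay hT (q + M)
  refine Summable.of_nonneg_of_le (fun p => ?_) (fun p => ?_) (hM.mul_left C)
  · split_ifs <;> positivity
  · split_ifs with hp
    · simp
    · have hpos : 0 < |lam p.1 - lam p.2| := abs_pos.mpr (sub_ne_zero.mpr fun e => hp (h.inj e))
      rw [inv_pow, ← div_eq_mul_inv, le_div_iff₀ (by positivity)]
      refine le_trans ?_ (hd (lam p.1 - lam p.2))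
      rw [pow_add, mul_right_comm]
      gcongr
      linarith

theorem norm_sq_toL2_mode {ρ : ℝ → ℂ} (hρ : CTest T ρ) (x : ℝ) :
    ‖(hρ.mode x).toL2‖ ^ 2 ≤ ∫ t in Ioo 0 T, ‖(starRingEnd ℂ) (ρ t) * ρ t‖ := by
  have e : ‖(hρ.mode x).toL2‖ ^ 2 = ‖inner ℂ (hρ.mode x).toL2 (hρ.mode x).toL2‖ := by
    rw [inner_self_eq_norm_sq_to_K]; simp
  rw [e, inner_mode hρ hρ]
  exact norm_hat_le _ _ _

theorem SparseFreq.isBessel_mode (h : SparseFreq lam) (hT : 0 ≤ T) {ρ : ℝ → ℂ} (hρ : CTest T ρ) :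
    IsBessel fun i => (hρ.mode (lam i)).toL2 := by
  refine isBessel_of_gram (fun i => norm_sq_toL2_mode hρ _) ?_
  convert h.summable_hat hT (hρ.conj.mul hρ.smooth) 0 using 3 with p
  rw [inner_mode hρ hρ, pow_zero, one_mul]

theorem CTest.toL2_eq_add_smul {f g h : ℝ → ℂ} (hf : CTest T f) (hg : CTest T g) (hh : CTest T h)
    (c : ℂ) (e : f = fun t => g t + c * h t) : hf.toL2 = hg.toL2 + c • hh.toL2 := by
  apply Lp.ext
  filter_upwards [hf.coeFn_toL2, hg.coeFn_toL2, hh.coeFn_toL2,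
    Lp.coeFn_add hg.toL2 (c • hh.toL2), Lp.coeFn_smul c hh.toL2] with t h1 h2 h3 h4 h5
  rw [h1, h4, Pi.add_apply, h5, Pi.smul_apply, h2, h3, e, smul_eq_mul]

/-- Induction on `m` with the profile free: the term with `deriv ρ` gains a factor `λ⁻¹`, bounded
because `|λ| ≥ δ`, and the other term has the factor `-iλ`, which the extra `λ⁻¹` cancels. -/
theorem SparseFreq.isBessel_iteratedDeriv_mode (h : SparseFreq lam) (hT : 0 ≤ T) (m : ℕ)
    {ρ : ℝ → ℂ} (hρ : CTest T ρ) :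
    IsBessel fun i => ((lam i : ℂ) ^ m)⁻¹ • ((hρ.mode (lam i)).iteratedDeriv m).toL2 := by
  induction m generalizing ρ with
  | zero =>
    convert h.isBessel_mode hT hρ using 2 with i
    rw [pow_zero, inv_one, one_smul]
    congr 1
  | succ m ih =>
    obtain ⟨δ, hδ, hlam⟩ := h.pos
    have h1 := (ih hρ.deriv).smul (c := fun i => (lam i : ℂ)⁻¹) (B := δ⁻¹) fun i => by
      rw [norm_inv, Complex.norm_real, Real.norm_eq_abs]
      exact inv_anti₀ hδ (hlam i)
    have h2 := (ih hρ).smul (c := fun _ => -Complex.I) (B := 1) fun i => by simp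
    convert h1.add h2 using 2 with i
    rw [CTest.toL2_eq_add_smul ((hρ.mode (lam i)).iteratedDeriv (m + 1))
      ((hρ.deriv.mode (lam i)).iteratedDeriv m) ((hρ.mode (lam i)).iteratedDeriv m) _
      (iteratedDeriv_succ_mode hρ (lam i) m), smul_add, smul_smul, smul_smul, smul_smul]
    have := h.ne_zero i
    have : (lam i : ℂ) ≠ 0 := by exact_mod_cast this
    congr 2
    · rw [pow_succ, mul_inv, mul_comm]
    · rw [pow_succ]; field_simp

/-! ### The weighted Gram matrix -/

/-- Off-diagonal part of the Gram matrix, conjugated by the weights `λ^q`. -/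
def gramKernel (T : ℝ) (lam : ι → ℝ) (ρ : ℝ → ℂ) (q : ℕ) (l j : ι) : ℂ :=
  if l = j then 0 else (lam l : ℂ) ^ q * ((lam j : ℂ) ^ q)⁻¹ * hat T ρ (lam l - lam j)

/-- A Peetre-type inequality: a ratio of weights costs only one power of the frequency difference,
which the decay of the Fourier transform pays for. -/
theorem SparseFreq.exists_ratio (h : SparseFreq lam) : ∃ c : ℝ, 1 ≤ c ∧
    ∀ l j, |lam l| ≤ c * (1 + |lam l - lam j|) * |lam j| := by
  obtain ⟨δ, hδ, hlam⟩ := h.pos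
  have h5 : 0 ≤ δ⁻¹ := by positivity
  refine ⟨1 + δ⁻¹, by linarith, fun l j => ?_⟩
  have h1 : |lam l| ≤ |lam l - lam j| + |lam j| := by
    simpa using abs_add_le (lam l - lam j) (lam j)
  have h2 : 1 ≤ δ⁻¹ * |lam j| := by
    rw [inv_mul_eq_div, le_div_iff₀ hδ, one_mul]; exact hlam j
  have h3 := mul_le_mul_of_nonneg_left h2 (abs_nonneg (lam l - lam j))
  nlinarith [mul_nonneg h5 (abs_nonneg (lam j)),
    mul_nonneg (abs_nonneg (lam l - lam j)) (abs_nonneg (lam j))]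

theorem SparseFreq.summable_gramKernel (h : SparseFreq lam) (hT : 0 ≤ T) {ρ : ℝ → ℂ}
    (hρ : CTest T ρ) (q : ℕ) : Summable fun p : ι × ι => ‖gramKernel T lam ρ q p.1 p.2‖ := by
  obtain ⟨c, hc, hr⟩ := h.exists_ratio
  refine Summable.of_nonneg_of_le (fun _ => norm_nonneg _) (fun p => ?_)
    ((h.summable_hat hT hρ q).mul_left (c ^ q))
  unfold gramKernel
  split_ifs with hp
  · simp
  · rw [norm_mul, norm_mul, norm_inv, norm_pow, norm_pow, Complex.norm_real, Complex.norm_real,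
      Real.norm_eq_abs, Real.norm_eq_abs, ← mul_assoc]
    refine mul_le_mul_of_nonneg_right ?_ (norm_nonneg _)
    rw [← div_eq_mul_inv, ← div_pow, ← mul_pow]
    refine pow_le_pow_left₀ (by positivity) ?_ _
    rw [div_le_iff₀ (abs_pos.mpr (h.ne_zero _))]
    exact hr _ _

/-- The normalization `hat T ρ 0 = 1` turns the diagonal of the moment matrix into the identity,
which leaves identity plus compact. -/
theorem hasSum_gram_row (h : SparseFreq lam) (hT : 0 ≤ T) {ρ : ℝ → ℂ}
    (hρ : CTest T ρ) (h1 : hat T ρ 0 = 1) (q : ℕ) (x : Ell2 ι) (l : ι) :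
    HasSum (fun j => (lam l : ℂ) ^ q * ((lam j : ℂ) ^ q)⁻¹ * hat T ρ (lam l - lam j) * x j)
      ((x + matOp (gramKernel T lam ρ q) x : Ell2 ι) l) := by
  have hA := h.summable_gramKernel hT hρ q
  have h2 := (summable_row hA x l).hasSum
  rw [← matOp_apply hA] at h2
  have h3 := (hasSum_ite_eq l (x l)).add h2
  refine h3.congr_fun fun j => ?_
  unfold gramKernel
  by_cases hj : j = l
  · subst hj
    have : (lam j : ℂ) ^ q ≠ 0 := pow_ne_zero _ (by exact_mod_cast h.ne_zero j)
    simp [h1, mul_inv_cancel₀ this]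
  · rw [if_neg hj, if_neg (Ne.symm hj), zero_add]

/-! ### Injectivity and invertibility of the Gram operator -/

/-- A nonnegative bounded sequence with `x ≤ e x`, `e` a summable matrix, is controlled by
finitely many of its terms. -/
theorem exists_finset_sup_bound {e : ι → ι → ℝ} (he : ∀ l j, 0 ≤ e l j)
    (hs : Summable fun p : ι × ι => e p.1 p.2) :
    ∃ F : Finset ι, ∃ C : ℝ, 0 ≤ C ∧ ∀ x : ι → ℝ, (∀ i, 0 ≤ x i) → BddAbove (range x) →
      (∀ l, x l ≤ ∑' j, e l j * x j) → ∀ m : ℝ, 0 ≤ m → (∀ i ∈ F, x i ≤ m) → ∀ l, x l ≤ C * m := by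
  -- Outside the finite set `P` of pairs less than half of a unit of mass remains, so the columns
  -- that `P` does not meet contribute a contraction.
  obtain ⟨P, hP⟩ := summable_iff_vanishing_norm.mp hs (1 / 2) (by norm_num)
  set E := ∑' p : ι × ι, e p.1 p.2 with hE
  have hE0 : 0 ≤ E := tsum_nonneg fun p => he _ _
  refine ⟨P.image Prod.snd, 2 * E, by positivity, fun x hx hb hle m hm hF l₀ => ?_⟩
  have hrow : ∀ l, Summable (e l) := fun l => hs.prod_factor l
  have htail : ∀ l, ∑' j, (if j ∈ P.image Prod.snd then 0 else e l j) ≤ 1 / 2 := by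
    intro l
    refine Real.tsum_le_of_sum_le (fun j => by split_ifs <;> simp [he]) fun s => ?_
    rw [Finset.sum_ite, Finset.sum_const_zero, zero_add]
    have hd : Disjoint ((s.filter (· ∉ P.image Prod.snd)).image fun j => (l, j)) P := by
      rw [Finset.disjoint_left]
      intro p hp hp'
      obtain ⟨j, hj, rfl⟩ := Finset.mem_image.mp hp
      exact (Finset.mem_filter.mp hj).2 (Finset.mem_image.mpr ⟨_, hp', rfl⟩)
    have := hP _ hd
    rw [Finset.sum_image (by intro a _ b _ hab; exact (Prod.ext_iff.mp hab).2)] at this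
    exact (le_abs_self _).trans this.le
  have htot : ∀ l, ∑' j, e l j ≤ E := by
    intro l
    refine Real.tsum_le_of_sum_le (he l) fun s => ?_
    have := hs.sum_le_tsum (s.image fun j => (l, j)) fun p _ => he _ _
    rwa [Finset.sum_image (by intro a _ b _ hab; exact (Prod.ext_iff.mp hab).2)] at this
  have hsup : ∀ l, x l ≤ ⨆ i, x i := fun l => le_ciSup hb l
  set X := ⨆ i, x i
  have hX : 0 ≤ X := (hx l₀).trans (hsup l₀)
  -- Taking the supremum over `l` and absorbing `X / 2` gives `X ≤ 2 * E * m`; boundedness of `x` is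
  -- what makes the absorption legitimate.
  have step : ∀ l, x l ≤ E * m + X / 2 := by
    intro l
    have hs2 : Summable fun j => (if j ∈ P.image Prod.snd then 0 else e l j) :=
      (hrow l).of_nonneg_of_le (fun j => by split_ifs <;> simp [he])
        (fun j => by split_ifs <;> simp [he])
    have hs3 : Summable fun j => e l j * m + (if j ∈ P.image Prod.snd then 0 else e l j) * X :=
      ((hrow l).mul_right m).add (hs2.mul_right X)
    have hpt : ∀ j, e l j * x j ≤
        e l j * m + (if j ∈ P.image Prod.snd then 0 else e l j) * X := by
      intro j
      split_ifs with hj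
      · rw [zero_mul, add_zero]
        exact mul_le_mul_of_nonneg_left (hF j hj) (he _ _)
      · have := mul_le_mul_of_nonneg_left (hsup j) (he l j)
        have := mul_nonneg (he l j) hm
        linarith
    refine (hle l).trans ((Summable.tsum_le_tsum hpt (hs3.of_nonneg_of_le
      (fun j => mul_nonneg (he _ _) (hx _)) hpt) hs3).trans ?_)
    rw [((hrow l).mul_right m).tsum_add (hs2.mul_right X), tsum_mul_right, tsum_mul_right]
    have h1 := mul_le_mul_of_nonneg_right (htot l) hm
    have h2 := mul_le_mul_of_nonneg_right (htail l) hX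
    linarith
  have : Nonempty ι := ⟨l₀⟩
  have := ciSup_le step
  have := hsup l₀
  change X ≤ _ at *
  linarith

/-- The Gram operator of the exponentials is injective on `ℓ²`. -/
theorem SparseFreq.gram_injective (h : SparseFreq lam) (hT : 0 ≤ T) {σ : ℝ → ℂ} (hσ : CTest T σ)
    (hreal : ∀ t, (starRingEnd ℂ) (σ t) = σ t) (hρ : CTest T fun t => σ t * σ t)
    (h1 : hat T (fun t => σ t * σ t) 0 = 1) (x : Ell2 ι)
    (hx : x + matOp (gramKernel T lam (fun t => σ t * σ t) 0) x = 0) : x = 0 := by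
  set ρ : ℝ → ℂ := fun t => σ t * σ t with hρdef
  set A := matOp (gramKernel T lam ρ 0) with hA
  obtain ⟨S, hS⟩ := (h.isBessel_mode hT hσ).exists_synthesis
  have hrow : ∀ (x : Ell2 ι) (l : ι),
      HasSum (fun j => hat T ρ (lam l - lam j) * x j) ((x + A x : Ell2 ι) l) := by
    intro x l
    simpa using hasSum_gram_row h hT hρ h1 0 x l
  have hinner : ∀ {θ : ℝ → ℂ} (hθ : CTest T θ) (x : Ell2 ι) (l : ι),
      HasSum (fun j => hat T (fun t => (starRingEnd ℂ) (θ t) * σ t) (lam l - lam j) * x j)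
        (inner ℂ (hθ.mode (lam l)).toL2 (S x)) := by
    intro θ hθ x l
    have := (hS x).mapL (innerSL ℂ (hθ.mode (lam l)).toL2)
    simpa [innerSL_apply_apply, inner_smul_right, inner_mode hθ hσ, mul_comm] using this
  have hS0 : ∀ x : Ell2 ι, x + A x = 0 → S x = 0 := by
    intro x hx
    have h2 : ∀ l, inner ℂ (hσ.mode (lam l)).toL2 (S x) = 0 := by
      intro l
      have e := hrow x l
      rw [hx] at e
      have e' := hinner hσ x l
      simp only [hreal] at e'
      exact e'.unique e
    -- The kernel equation says that `S x` is orthogonal to every mode; as a sum of modes it is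
    -- orthogonal to itself.
    have h3 := (hS x).mapL (innerSL ℂ (S x))
    simp only [innerSL_apply_apply, inner_smul_right] at h3
    have h4 : ∀ i, inner ℂ (S x) (hσ.mode (lam i)).toL2 = 0 := fun i => by
      rw [← inner_conj_symm, h2, map_zero]
    simp only [h4, mul_zero] at h3
    exact inner_self_eq_zero.mp (h3.unique hasSum_zero)
  obtain ⟨c, hc1, hratio⟩ := h.exists_ratio
  set e : ι → ι → ℝ := fun l j => c * (if l = j then 0 else
      (1 + |lam l - lam j|) ^ 1 * ‖hat T ρ (lam l - lam j)‖) with he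
  have he0 : ∀ l j, 0 ≤ e l j := by
    intro l j
    simp only [he]
    split_ifs <;> positivity
  have hes : Summable fun p : ι × ι => e p.1 p.2 := (h.summable_hat hT hρ 1).mul_left c
  obtain ⟨F, C, hC, hF⟩ := exists_finset_sup_bound he0 hes
  -- For any weight of moderate growth, the off-diagonal part of the kernel equation bounds the
  -- weighted sequence by itself through `e`.
  have hle : ∀ x : Ell2 ι, x + A x = 0 → ∀ w : ι → ℝ, (∀ i, 0 ≤ w i) →
      (∀ l j, w l ≤ c * (1 + |lam l - lam j|) * w j) → BddAbove (range fun i => w i * ‖x i‖) →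
      ∀ l, w l * ‖x l‖ ≤ ∑' j, e l j * (w j * ‖x j‖) := by
    intro x hx w hw0 hw ⟨B, hB⟩ l
    have hs : Summable fun j => e l j * (w j * ‖x j‖) := by
      refine Summable.of_nonneg_of_le (fun j => ?_) (fun j => ?_)
        ((hes.prod_factor l).mul_right B)
      · have := he0 l j; have := hw0 j; positivity
      · exact mul_le_mul_of_nonneg_left (hB ⟨j, rfl⟩) (he0 l j)
    have h2 : x l = -(A x l) := by
      have := congrArg (fun y : Ell2 ι => y l) hx
      exact eq_neg_of_add_eq_zero_left this
    have hK := h.summable_gramKernel hT hρ 0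
    rw [h2, norm_neg, hA, matOp_apply hK]
    have hn : Summable fun j => ‖gramKernel T lam ρ 0 l j * x j‖ := (summable_row hK x l).norm
    refine (mul_le_mul_of_nonneg_left (norm_tsum_le_tsum_norm hn) (hw0 l)).trans ?_
    rw [← tsum_mul_left]
    refine Summable.tsum_le_tsum (fun j => ?_) (hn.mul_left _) hs
    simp only [he, gramKernel]
    split_ifs with hlj
    · simp
    · rw [pow_zero, pow_zero, inv_one, one_mul, one_mul, norm_mul, pow_one]
      have := mul_le_mul_of_nonneg_right (hw l j)
        (mul_nonneg (norm_nonneg (hat T ρ (lam l - lam j))) (norm_nonneg (x j)))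
      calc _ ≤ _ := this
        _ = _ := by ring
  have hshift : ∀ x : Ell2 ι, x + A x = 0 →
      ∃ y : Ell2 ι, y + A y = 0 ∧ ∀ i, y i = (lam i : ℂ) * x i := by
    intro x hx
    have hbound : ∀ l, |lam l| * ‖x l‖ ≤ C * ∑ i ∈ F, |lam i| * ‖x i‖ := by
      intro l
      obtain ⟨δ, hδ, hlam⟩ := h.pos
      -- The weight `|λ|` is truncated at `R` so that the weighted sequence is known to be bounded.
      -- The resulting bound does not depend on `R`, and the truncation is inactive at `l`.
      set R := max δ |lam l| with hR
      have hR0 : 0 < R := lt_max_of_lt_left hδ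
      have hmin : ∀ i j, min |lam i| R ≤ c * (1 + |lam i - lam j|) * min |lam j| R := by
        intro i j
        rcases le_total |lam j| R with hj | hj
        · rw [min_eq_left hj]
          exact (min_le_left _ _).trans (hratio i j)
        · rw [min_eq_right hj]
          refine (min_le_right _ _).trans (le_mul_of_one_le_left hR0.le ?_)
          nlinarith [abs_nonneg (lam i - lam j)]
      have hw0 : ∀ i, 0 ≤ min |lam i| R := fun i => le_min (abs_nonneg _) hR0.le
      have hb : BddAbove (range fun i => min |lam i| R * ‖x i‖) := by
        refine ⟨R * ‖x‖, ?_⟩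
        rintro _ ⟨i, rfl⟩
        exact mul_le_mul (min_le_right _ _) (lp.norm_apply_le_norm (by norm_num) x i)
          (norm_nonneg _) hR0.le
      have := hF _ (fun i => mul_nonneg (hw0 i) (norm_nonneg _)) hb (hle x hx _ hw0 hmin hb)
        (∑ i ∈ F, |lam i| * ‖x i‖) (Finset.sum_nonneg fun i _ => by positivity)
        (fun i hi => (mul_le_mul_of_nonneg_right (min_le_left _ _) (norm_nonneg _)).trans
          (Finset.single_le_sum (f := fun i => |lam i| * ‖x i‖)
            (fun i _ => by positivity) hi)) l
      rwa [min_eq_left (le_max_right _ _)] at this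
    set B := C * ∑ i ∈ F, |lam i| * ‖x i‖
    have hb : BddAbove (range fun i => |lam i| * ‖x i‖) := by
      refine ⟨B, ?_⟩
      rintro _ ⟨i, rfl⟩
      exact hbound i
    have hle' := hle x hx _ (fun i => abs_nonneg (lam i)) hratio hb
    -- One more use of the kernel inequality upgrades the uniform bound to an `ℓ¹` bound, since `e`
    -- is summable over all pairs.
    have hsum1 : Summable fun l => |lam l| * ‖x l‖ := by
      refine Summable.of_nonneg_of_le (fun l => by positivity) (fun l => (hle' l).trans ?_)
        (hes.prod.mul_right B)
      rw [← tsum_mul_right]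
      refine Summable.tsum_le_tsum (fun j => mul_le_mul_of_nonneg_left (hbound j) (he0 l j)) ?_
        ((hes.prod_factor l).mul_right B)
      refine Summable.of_nonneg_of_le (fun j => ?_)
        (fun j => mul_le_mul_of_nonneg_left (hbound j) (he0 l j))
        ((hes.prod_factor l).mul_right B)
      have := he0 l j; positivity
    have hmem : Memℓp (fun i => (lam i : ℂ) * x i) 2 := by
      refine Memℓp.of_exponent_ge (q := 1) (memℓp_gen ?_) one_le_two
      simpa using hsum1
    refine ⟨⟨_, hmem⟩, ?_, fun i => rfl⟩
    -- The conjugate of `θ` is `2σ'`, so `conj θ · σ = (σ²)'`. Pairing with `S x = 0` gives `∑ (λ_l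
    -- - λ_j) ρ̂(λ_l - λ_j) x_j = 0`, hence the Gram matrix applied to `λx` equals `λ_l` times its
    -- value on `x`, which is zero.
    have hθ := hσ.deriv.conj.add hσ.deriv.conj
    have hSx := hS0 x hx
    ext l
    have e1 := hrow ⟨_, hmem⟩ l
    have e2 := (hrow x l).mul_left (lam l : ℂ)
    have e3 := (hinner hθ x l).mul_left Complex.I
    have e4 : ∀ t, (starRingEnd ℂ) ((starRingEnd ℂ) (deriv σ t) + (starRingEnd ℂ) (deriv σ t)) *
        σ t = deriv ρ t := by
      intro t
      rw [((hσ.hasDerivAt t).fun_mul (hσ.hasDerivAt t)).deriv, map_add, Complex.conj_conj]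
      ring
    simp only [e4] at e3
    have e5 := (e2.sub e3).unique (e1.congr_fun fun j => ?_)
    · rw [← e5, hx, hSx, inner_zero_right]
      simp
    · have := hat_deriv hT hρ (lam l - lam j)
      change hat T (deriv ρ) _ = _ at this
      rw [show (fun t => deriv ρ t) = deriv ρ from rfl, this]
      change _ = hat T ρ (lam l - lam j) * ((lam j : ℂ) * x j)
      push_cast
      linear_combination (((lam l : ℂ) - lam j) * hat T ρ (lam l - lam j) * x j) * Complex.I_sq
  have hprod : ∀ (x : Ell2 ι), x + A x = 0 → ∀ G : Finset ι,
      ∃ y : Ell2 ι, y + A y = 0 ∧ ∀ i, y i = (∏ f ∈ G, ((lam i : ℂ) - lam f)) * x i := by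
    intro x hx G
    induction G using Finset.induction_on with
    | empty => exact ⟨x, hx, by simp⟩
    | insert f G hf ih =>
      obtain ⟨y, hy, hyx⟩ := ih
      obtain ⟨z, hz, hzy⟩ := hshift y hy
      refine ⟨z - (lam f : ℂ) • y, ?_, fun i => ?_⟩
      · rw [map_sub, map_smul]
        have : z - (lam f : ℂ) • y + (A z - (lam f : ℂ) • A y) =
          (z + A z) - (lam f : ℂ) • (y + A y) := by rw [smul_add]; abel
        rw [this, hz, hy, smul_zero, sub_zero]
      · rw [lp.coeFn_sub, Pi.sub_apply, lp.coeFn_smul, Pi.smul_apply, hzy, smul_eq_mul, hyx,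
          Finset.prod_insert hf]
        ring
  have hvanish : ∀ y : Ell2 ι, y + A y = 0 → (∀ i ∈ F, y i = 0) → ∀ i, y i = 0 := by
    intro y hy hyF i
    have hb : BddAbove (range fun i => (1 : ℝ) * ‖y i‖) := by
      refine ⟨‖y‖, ?_⟩
      rintro _ ⟨i, rfl⟩
      exact (one_mul _).trans_le (lp.norm_apply_le_norm (by norm_num) y i)
    have := hF _ (fun i => by positivity) hb (hle y hy (fun _ => 1) (fun _ => zero_le_one)
      (fun l j => by nlinarith [abs_nonneg (lam l - lam j)]) hb) 0 le_rfl
      (fun i hi => by rw [hyF i hi]; simp) i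
    rw [one_mul, mul_zero] at this
    exact norm_le_zero_iff.mp this
  have hne : ∀ (i : ι) (G : Finset ι), i ∉ G → (∏ f ∈ G, ((lam i : ℂ) - lam f)) ≠ 0 := by
    intro i G hi
    refine Finset.prod_ne_zero_iff.mpr fun f hf => sub_ne_zero.mpr fun e => hi ?_
    rwa [h.inj (by exact_mod_cast e : lam i = lam f)]
  have hout : ∀ i, i ∉ F → x i = 0 := by
    intro i hi
    obtain ⟨y, hy, hyx⟩ := hprod x hx F
    have := hvanish y hy (fun f hf => by
      rw [hyx, Finset.prod_eq_zero hf (sub_self _), zero_mul]) i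
    rw [hyx] at this
    exact (mul_eq_zero.mp this).resolve_left (hne i F hi)
  -- Only the coordinates in `F` are left. The product over `F.erase i` isolates coordinate `i`, and
  -- the diagonal entry `1` makes it vanish.
  ext i
  obtain ⟨y, hy, hyx⟩ := hprod x hx (F.erase i)
  have hy0 : ∀ j, j ≠ i → y j = 0 := by
    intro j hj
    rw [hyx]
    by_cases hjF : j ∈ F
    · rw [Finset.prod_eq_zero (Finset.mem_erase.mpr ⟨hj, hjF⟩) (sub_self _), zero_mul]
    · rw [hout j hjF, mul_zero]
  have e1 := hrow y i
  rw [hy] at e1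
  have e2 := e1.unique (hasSum_single i fun j hj => by rw [hy0 j hj, mul_zero])
  rw [sub_self, h1, one_mul, hyx] at e2
  exact (mul_eq_zero.mp e2.symm).resolve_left (hne i _ (Finset.notMem_erase i F))

/-- For every `q ≥ 0`, the Gram operator is invertible on the space with weight `λ^q`. -/
theorem SparseFreq.exists_gram_inverse (h : SparseFreq lam) (hT : 0 ≤ T) {σ : ℝ → ℂ}
    (hσ : CTest T σ) (hreal : ∀ t, (starRingEnd ℂ) (σ t) = σ t) (hρ : CTest T fun t => σ t * σ t)
    (h1 : hat T (fun t => σ t * σ t) 0 = 1) (q : ℕ) :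
    ∃ R : Ell2 ι →L[ℂ] Ell2 ι,
      (∀ y, R y + matOp (gramKernel T lam (fun t => σ t * σ t) q) (R y) = y) ∧
      ∀ x, R (x + matOp (gramKernel T lam (fun t => σ t * σ t) q) x) = x := by
  refine exists_inverse_one_add_matOp (h.summable_gramKernel hT hρ q) fun x hx => ?_
  obtain ⟨δ, hδ, hlam⟩ := h.pos
  have hlq : ∀ i, (lam i : ℂ) ^ q ≠ 0 := fun i => pow_ne_zero _ (by exact_mod_cast h.ne_zero i)
  obtain ⟨D, hD⟩ := exists_diagonal (c := fun i => ((lam i : ℂ) ^ q)⁻¹) (B := (δ ^ q)⁻¹)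
    fun i => by
      rw [norm_inv, norm_pow, Complex.norm_real, Real.norm_eq_abs]
      exact inv_anti₀ (by positivity) (pow_le_pow_left₀ hδ.le (hlam i) q)
  -- Dividing by `λ^q`, a bounded operation on `ℓ²`, maps the weighted kernel into the unweighted
  -- one.
  have hy := h.gram_injective hT hσ hreal hρ h1 (D x) (by
    ext l
    have e1 := (hasSum_gram_row h hT hρ h1 q x l).mul_left ((lam l : ℂ) ^ q)⁻¹
    have e2 := hasSum_gram_row h hT hρ h1 0 (D x) l
    rw [hx] at e1
    refine (e2.unique (e1.congr_fun fun j => ?_)).trans (mul_zero _)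
    rw [hD]
    simp only [pow_zero, inv_one, one_mul]
    linear_combination (-(((lam j : ℂ) ^ q)⁻¹ * hat T (fun t => σ t * σ t) (lam l - lam j) * x j)) *
      inv_mul_cancel₀ (hlq l))
  ext i
  have := congrArg (fun y : Ell2 ι => y i) hy
  simp only [hD] at this
  exact (mul_eq_zero.mp this).resolve_left (inv_ne_zero (hlq i))

end Sparse

/-! ### One solution, estimates of all orders -/

section Solver

variable {ι : Type*} [DecidableEq ι] {lam : ι → ℝ} {T : ℝ}

/-- Simultaneous resolution of the moment problem at all orders `q ≤ s`. Here `z = λ^s b`, where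
`b` are the data, and `y = λ^s a`, where `a` are the coefficients of the solution
`∑ a_i ρ e^{-iλ_i t}`. -/
theorem SparseFreq.exists_solver (h : SparseFreq lam) (hT : 0 ≤ T) {σ : ℝ → ℂ}
    (hσ : CTest T σ) (hreal : ∀ t, (starRingEnd ℂ) (σ t) = σ t) (hρ : CTest T fun t => σ t * σ t)
    (h1 : hat T (fun t => σ t * σ t) 0 = 1) (s : ℕ) :
    ∃ y : Ell2 ι →L[ℂ] Ell2 ι,
      (∀ z l, HasSum (fun i => (((lam i : ℂ) ^ s)⁻¹ * y z i) *
        hat T (fun t => σ t * σ t) (lam l - lam i)) (((lam l : ℂ) ^ s)⁻¹ * z l)) ∧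
      ∀ q ≤ s, ∃ W : Ell2 ι →L[ℂ] Lp ℂ 2 (μI T),
        (∀ z, HasSum (fun i => (((lam i : ℂ) ^ s)⁻¹ * y z i) •
          ((hρ.mode (lam i)).iteratedDeriv q).toL2) (W z)) ∧
        ∃ C : ℝ, 0 ≤ C ∧ ∀ z w : Ell2 ι, (∀ i, w i = ((lam i : ℂ) ^ (s - q))⁻¹ * z i) →
          ‖W z‖ ≤ C * ‖w‖ := by
  obtain ⟨δ, hδ, hlam⟩ := h.pos
  have hne : ∀ i, (lam i : ℂ) ≠ 0 := fun i => by exact_mod_cast h.ne_zero i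
  obtain ⟨R, hR, -⟩ := h.exists_gram_inverse hT hσ hreal hρ h1 s
  refine ⟨R, fun z l => ?_, fun q hq => ?_⟩
  · have e := (hasSum_gram_row h hT hρ h1 s (R z) l).mul_left ((lam l : ℂ) ^ s)⁻¹
    rw [hR] at e
    refine e.congr_fun fun i => ?_
    linear_combination (-(((lam i : ℂ) ^ s)⁻¹ * hat T (fun t => σ t * σ t) (lam l - lam i) *
      R z i)) * inv_mul_cancel₀ (pow_ne_zero s (hne l))
  · obtain ⟨Rq, -, hRq⟩ := h.exists_gram_inverse hT hσ hreal hρ h1 q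
    obtain ⟨S, hS⟩ := (h.isBessel_iteratedDeriv_mode hT q hρ).exists_synthesis
    obtain ⟨D, hD⟩ := exists_diagonal (c := fun i => ((lam i : ℂ) ^ (s - q))⁻¹)
      (B := (δ ^ (s - q))⁻¹) fun i => by
        rw [norm_inv, norm_pow, Complex.norm_real, Real.norm_eq_abs]
        exact inv_anti₀ (by positivity) (pow_le_pow_left₀ hδ.le (hlam i) _)
    refine ⟨S.comp (D.comp R), fun z => ?_, ‖S‖ * ‖Rq‖, by positivity, fun z w hw => ?_⟩
    · refine (hS (D (R z))).congr_fun fun i => ?_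
      rw [smul_smul, hD]
      congr 1
      rw [← Nat.sub_add_cancel hq, pow_add, mul_inv, Nat.add_sub_cancel]
      ring
    · have hDw : D z = w := by
        ext i
        rw [hD, hw]
      -- Dividing the system of weight `s` by `λ^{s-q}` gives the system of weight `q`. Left
      -- invertibility then identifies `D (R z)` with `Rq w`, so the norm of `w` alone controls the
      -- solution at order `q`.
      have hcomm : D (R z) + matOp (gramKernel T lam (fun t => σ t * σ t) q) (D (R z)) = w := by
        ext l
        have e := (hasSum_gram_row h hT hρ h1 s (R z) l).mul_left ((lam l : ℂ) ^ (s - q))⁻¹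
        rw [hR, ← hw] at e
        refine (hasSum_gram_row h hT hρ h1 q (D (R z)) l).unique (e.congr_fun fun i => ?_)
        rw [hD, ← Nat.sub_add_cancel hq, pow_add, pow_add, mul_inv, Nat.add_sub_cancel]
        linear_combination (-((lam l : ℂ) ^ q * ((lam i : ℂ) ^ (s - q))⁻¹ * ((lam i : ℂ) ^ q)⁻¹ *
          hat T (fun t => σ t * σ t) (lam l - lam i) * R z i)) *
          inv_mul_cancel₀ (pow_ne_zero (s - q) (hne l))
      have e2 := hRq (D (R z))
      rw [hcomm] at e2
      change ‖S (D (R z))‖ ≤ _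
      rw [← e2, mul_assoc]
      exact (S.le_opNorm _).trans (mul_le_mul_of_nonneg_left (Rq.le_opNorm _) (norm_nonneg _))

end Solver

/-! ### Moments of `L²` functions -/

theorem memLp_exp_I (T x : ℝ) :
    MemLp (fun t : ℝ => Complex.exp (Complex.I * x * t)) 2 (μI T) :=
  MemLp.of_bound (contDiff_exp_I x).continuous.aestronglyMeasurable 1
    (Filter.Eventually.of_forall fun t => (norm_exp_I_mul_mul x t).le)

/-- `w ↦ ∫₀ᵀ w(t) e^{ixt} dt` on `L²((0, T), ℂ)`. -/
def momentL (T x : ℝ) : Lp ℂ 2 (μI T) →L[ℂ] ℂ := innerSL ℂ (memLp_exp_I T (-x)).toLp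

theorem momentL_apply (T x : ℝ) (w : Lp ℂ 2 (μI T)) :
    momentL T x w = ∫ t in Ioo 0 T, w t * Complex.exp (Complex.I * x * t) := by
  rw [momentL, innerSL_apply_apply, L2.inner_def]
  apply integral_congr_ae
  filter_upwards [(memLp_exp_I T (-x)).coeFn_toLp] with t ht
  rw [ht, RCLike.inner_apply, ← Complex.exp_conj]
  simp

theorem momentL_toL2 {T : ℝ} (x : ℝ) {g : ℝ → ℂ} (hg : CTest T g) :
    momentL T x hg.toL2 = hat T g x := by
  rw [momentL_apply, hat]
  apply integral_congr_ae
  filter_upwards [hg.coeFn_toL2] with t ht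
  rw [ht]

/-- The real part, from `L²((0, T), ℂ)` to `L²((0, T), ℝ)`. -/
def reL (T : ℝ) : Lp ℂ 2 (μI T) →L[ℝ] L2 T := Complex.reCLM.compLpL 2 (μI T)

theorem coeFn_reL {T : ℝ} (w : Lp ℂ 2 (μI T)) : reL T w =ᵐ[μI T] fun t => (w t).re :=
  Complex.reCLM.coeFn_compLpL w

theorem norm_reL_le {T : ℝ} (w : Lp ℂ 2 (μI T)) : ‖reL T w‖ ≤ ‖w‖ := by
  refine Lp.norm_le_norm_of_ae_le ?_
  filter_upwards [coeFn_reL w] with t ht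
  rw [ht, Real.norm_eq_abs]
  exact Complex.abs_re_le_norm _

/-- `∫₀ᵀ u(t) e^{ixt} dt` for real-valued `u`. -/
def realMoment (T x : ℝ) (u : L2 T) : ℂ :=
  ∫ t in (0 : ℝ)..T, ((u t : ℝ) : ℂ) * Complex.exp (Complex.I * (x : ℂ) * (t : ℂ))

theorem integrable_realMoment (T x : ℝ) (u : L2 T) :
    Integrable (fun t => ((u t : ℝ) : ℂ) * Complex.exp (Complex.I * (x : ℂ) * (t : ℂ)))
      (μI T) :=
  ((Lp.memLp u).ofReal (K := ℂ)).integrable_mul (memLp_exp_I T x)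

theorem realMoment_eq {T : ℝ} (hT : 0 ≤ T) (x : ℝ) (u : L2 T) : realMoment T x u =
    ∫ t in Ioo 0 T, ((u t : ℝ) : ℂ) * Complex.exp (Complex.I * (x : ℂ) * (t : ℂ)) := by
  rw [realMoment, intervalIntegral.integral_of_le hT, integral_Ioc_eq_integral_Ioo]

theorem realMoment_add {T : ℝ} (hT : 0 ≤ T) (x : ℝ) (u v : L2 T) :
    realMoment T x (u + v) = realMoment T x u + realMoment T x v := by
  rw [realMoment_eq hT, realMoment_eq hT, realMoment_eq hT,
    ← integral_add (integrable_realMoment T x u) (integrable_realMoment T x v)]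
  apply integral_congr_ae
  filter_upwards [Lp.coeFn_add u v] with t ht
  rw [ht, Pi.add_apply]
  push_cast
  ring

theorem realMoment_smul {T : ℝ} (hT : 0 ≤ T) (x : ℝ) (r : ℝ) (u : L2 T) :
    realMoment T x (r • u) = r * realMoment T x u := by
  rw [realMoment_eq hT, realMoment_eq hT, ← integral_const_mul]
  apply integral_congr_ae
  filter_upwards [Lp.coeFn_smul r u] with t ht
  rw [ht, Pi.smul_apply, smul_eq_mul]
  push_cast
  ring

/-- The real part mixes the frequencies `x` and `-x`; this is why the system is posed on a symmetric
set with conjugate data. -/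
theorem realMoment_reL {T : ℝ} (hT : 0 ≤ T) (x : ℝ) (w : Lp ℂ 2 (μI T)) :
    realMoment T x (reL T w) =
      (momentL T x w + (starRingEnd ℂ) (momentL T (-x) w)) / 2 := by
  rw [realMoment_eq hT, momentL_apply, momentL_apply, ← integral_conj, ← integral_add,
    ← integral_div]
  · apply integral_congr_ae
    filter_upwards [coeFn_reL w] with t ht
    rw [ht, map_mul, ← Complex.exp_conj, Complex.re_eq_add_conj]
    simp only [map_mul, Complex.conj_I, Complex.conj_ofReal]
    rw [show -Complex.I * ((-x : ℝ) : ℂ) * t = Complex.I * x * t by push_cast; ring]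
    ring
  · exact (Lp.memLp w).integrable_mul (memLp_exp_I T x)
  · exact (Complex.conjCLE : ℂ →L[ℝ] ℂ).integrable_comp
      ((Lp.memLp w).integrable_mul (memLp_exp_I T (-x)))

/-! ### The Volterra operator -/

/-- `u ↦ ∫₀ᵗ u`. -/
def primL (T t : ℝ) : L2 T →L[ℝ] ℝ :=
  innerSL ℝ (indicatorConstLp 2 (measurableSet_Ioo (a := (0 : ℝ)) (b := t))
    (measure_ne_top (μI T) _) (1 : ℝ))

theorem primL_apply {T t : ℝ} (h0 : 0 ≤ t) (ht : t ≤ T) (u : L2 T) :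
    primL T t u = ∫ τ in (0 : ℝ)..t, u τ := by
  rw [primL, innerSL_apply_apply, L2.inner_indicatorConstLp_one,
    intervalIntegral.integral_of_le h0, integral_Ioc_eq_integral_Ioo,
    Measure.restrict_restrict measurableSet_Ioo, inter_eq_left.mpr (Ioo_subset_Ioo_right ht)]

theorem norm_primL_le {T : ℝ} (hT : 0 ≤ T) (t : ℝ) (u : L2 T) :
    ‖primL T t u‖ ≤ Real.sqrt T * ‖u‖ := by
  refine (norm_inner_le_norm (𝕜 := ℝ) _ u).trans (mul_le_mul_of_nonneg_right ?_ (norm_nonneg u))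
  rw [norm_indicatorConstLp (by norm_num) (by norm_num), norm_one, one_mul, Real.sqrt_eq_rpow]
  simp only [ENNReal.toReal_ofNat]
  gcongr
  refine (measureReal_mono (subset_univ _)).trans ?_
  simp [measureReal_def, hT]

theorem integrableOn_L2 {T : ℝ} (u : L2 T) : IntegrableOn u (Ioo 0 T) :=
  memLp_one_iff_integrable.mp ((Lp.memLp u).mono_exponent one_le_two)

theorem memLp_primL {T : ℝ} (hT : 0 ≤ T) (u : L2 T) :
    MemLp (fun t => primL T t u) 2 (μI T) := by
  refine MemLp.of_bound ?_ (Real.sqrt T * ‖u‖) (Eventually.of_forall fun t => norm_primL_le hT t u)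
  have hc : ContinuousOn (fun t => ∫ τ in (0 : ℝ)..t, u τ) (uIcc 0 T) := by
    refine intervalIntegral.continuousOn_primitive_interval ?_
    rw [uIcc_of_le hT, integrableOn_Icc_iff_integrableOn_Ioo]
    exact integrableOn_L2 u
  rw [uIcc_of_le hT] at hc
  refine ((hc.mono Ioo_subset_Icc_self).congr fun t ht => ?_).aestronglyMeasurable
    measurableSet_Ioo
  exact primL_apply ht.1.le ht.2.le u

/-- The Volterra operator `u ↦ (t ↦ ∫₀ᵗ u)` on `L²(0, T)`. -/
theorem exists_volterra {T : ℝ} (hT : 0 ≤ T) :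
    ∃ J : L2 T →L[ℝ] L2 T, ∀ u, J u =ᵐ[μI T] fun t => ∫ τ in (0 : ℝ)..t, u τ := by
  let J₀ : L2 T →ₗ[ℝ] L2 T :=
    { toFun := fun u => (memLp_primL hT u).toLp _
      map_add' := fun u v => by
        rw [← MemLp.toLp_add]
        congr 1
        funext t
        exact map_add _ _ _
      map_smul' := fun r u => by
        rw [RingHom.id_apply, ← MemLp.toLp_const_smul]
        congr 1
        funext t
        exact map_smul _ _ _ }
  obtain ⟨K, hK⟩ : ∃ K : ℝ, ∀ u : L2 T, ‖J₀ u‖ ≤ K * ‖u‖ := by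
    refine ⟨(measureUnivNNReal (μI T) : ℝ) ^ ((2 : ℝ≥0∞).toReal)⁻¹ * Real.sqrt T, fun u => ?_⟩
    rw [mul_assoc]
    refine Lp.norm_le_of_ae_bound (by positivity) ?_
    filter_upwards [(memLp_primL hT u).coeFn_toLp] with t ht
    change ‖(memLp_primL hT u).toLp _ t‖ ≤ _
    rw [ht]
    exact norm_primL_le hT t u
  refine ⟨J₀.mkContinuous K hK, fun u => ?_⟩
  filter_upwards [(memLp_primL hT u).coeFn_toLp, ae_restrict_mem measurableSet_Ioo] with t h1 h2
  change (memLp_primL hT u).toLp _ t = _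
  rw [h1, primL_apply h2.1.le h2.2.le]

/-- The Volterra operator. -/
def volterra {T : ℝ} (hT : 0 ≤ T) : L2 T →L[ℝ] L2 T := (exists_volterra hT).choose

theorem coeFn_volterra {T : ℝ} (hT : 0 ≤ T) (u : L2 T) :
    volterra hT u =ᵐ[μI T] fun t => ∫ τ in (0 : ℝ)..t, u τ :=
  (exists_volterra hT).choose_spec u

theorem intervalIntegral_congr_L2 {T t : ℝ} (h0 : 0 ≤ t) (ht : t ≤ T) {f g : ℝ → ℝ}
    (h : f =ᵐ[μI T] g) : ∫ τ in (0 : ℝ)..t, f τ = ∫ τ in (0 : ℝ)..t, g τ := by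
  rw [intervalIntegral.integral_of_le h0, intervalIntegral.integral_of_le h0,
    integral_Ioc_eq_integral_Ioo, integral_Ioc_eq_integral_Ioo]
  exact integral_congr_ae (ae_restrict_of_ae_restrict_of_subset (Ioo_subset_Ioo_right ht) h)

/-- This replaces pointwise iterated integrals by powers of a bounded operator on `L²`, which can be
applied termwise to series. -/
theorem iterPrim_ae_eq {T : ℝ} (hT : 0 ≤ T) (u : L2 T) (n : ℕ) :
    iterPrim u n =ᵐ[μI T] ((volterra hT ^ n : L2 T →L[ℝ] L2 T) u : L2 T) := by
  induction n with
  | zero => exact ae_eq_refl _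
  | succ n ih =>
    rw [pow_succ']
    change _ =ᵐ[μI T] (volterra hT ((volterra hT ^ n : L2 T →L[ℝ] L2 T) u) : L2 T)
    filter_upwards [coeFn_volterra hT ((volterra hT ^ n : L2 T →L[ℝ] L2 T) u),
      ae_restrict_mem measurableSet_Ioo] with t h1 h2
    rw [h1]
    exact intervalIntegral_congr_L2 h2.1.le h2.2.le ih

theorem iterPrim_succ_apply {T : ℝ} (hT : 0 ≤ T) (u : L2 T) (n : ℕ) :
    iterPrim u (n + 1) T = primL T T ((volterra hT ^ n : L2 T →L[ℝ] L2 T) u) := by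
  rw [primL_apply hT le_rfl]
  exact intervalIntegral_congr_L2 hT le_rfl (iterPrim_ae_eq hT u n)

theorem negNorm_eq {T : ℝ} (hT : 0 ≤ T) (u : L2 T) (n : ℕ) :
    negNorm T n u = |primL T T u| + ‖(volterra hT ^ n : L2 T →L[ℝ] L2 T) u‖ := by
  unfold negNorm
  rw [iterPrim_succ_apply hT]
  congr 1
  rw [← Real.sqrt_sq (norm_nonneg _)]
  congr 1
  rw [intervalIntegral.integral_of_le hT, integral_Ioc_eq_integral_Ioo,
    ← real_inner_self_eq_norm_sq, L2.inner_def]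
  apply integral_congr_ae
  filter_upwards [iterPrim_ae_eq hT u n] with t ht
  rw [ht]
  simp [sq]

/-! ### Derivatives of real test functions under the Volterra operator -/

/-- The class of `φ^{(n)}` in `L²(0, T)`. -/
def IsTest.toL2 {T : ℝ} {φ : ℝ → ℝ} (hφ : IsTest T φ) (n : ℕ) : L2 T :=
  (hφ.memLp_iteratedDeriv n).toLp

theorem IsTest.coeFn_toL2 {T : ℝ} {φ : ℝ → ℝ} (hφ : IsTest T φ) (n : ℕ) :
    hφ.toL2 n =ᵐ[μI T] iteratedDeriv n φ := (hφ.memLp_iteratedDeriv n).coeFn_toLp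

theorem IsTest.eq_zero {T : ℝ} {φ : ℝ → ℝ} (hφ : IsTest T φ) {t : ℝ} (ht : t ∉ Ioo 0 T) :
    φ t = 0 :=
  image_eq_zero_of_notMem_tsupport fun h => ht (hφ.supp h)

theorem IsTest.deriv {T : ℝ} {φ : ℝ → ℝ} (hφ : IsTest T φ) : IsTest T (deriv φ) :=
  ⟨((contDiff_infty_iff_deriv (f := φ)).mp hφ.smooth).2, hφ.compact.deriv,
    (tsupport_deriv_subset (f := φ)).trans hφ.supp⟩

theorem IsTest.iteratedDeriv {T : ℝ} {φ : ℝ → ℝ} (hφ : IsTest T φ) (n : ℕ) :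
    IsTest T (iteratedDeriv n φ) := by
  induction n with
  | zero => simpa using hφ
  | succ n ih => rw [iteratedDeriv_succ]; exact ih.deriv

theorem IsTest.integral_deriv {T : ℝ} {φ : ℝ → ℝ} (hφ : IsTest T φ) (t : ℝ) :
    ∫ τ in (0 : ℝ)..t, _root_.deriv φ τ = φ t := by
  rw [intervalIntegral.integral_eq_sub_of_hasDerivAt
    (fun t _ => ((hφ.smooth.differentiable (by simp)) t).hasDerivAt)
    (hφ.deriv.smooth.continuous.intervalIntegrable _ _), hφ.eq_zero (t := 0) (by simp), sub_zero]

theorem IsTest.volterra_toL2 {T : ℝ} (hT : 0 ≤ T) {φ : ℝ → ℝ} (hφ : IsTest T φ) (n : ℕ) :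
    volterra hT (hφ.toL2 (n + 1)) = hφ.toL2 n := by
  apply Lp.ext
  filter_upwards [coeFn_volterra hT (hφ.toL2 (n + 1)), hφ.coeFn_toL2 n,
    ae_restrict_mem measurableSet_Ioo] with t h1 h2 h3
  rw [h1, h2, intervalIntegral_congr_L2 h3.1.le h3.2.le (hφ.coeFn_toL2 (n + 1)),
    iteratedDeriv_succ, (hφ.iteratedDeriv n).integral_deriv]

theorem IsTest.primL_toL2 {T : ℝ} (hT : 0 ≤ T) {φ : ℝ → ℝ} (hφ : IsTest T φ) (n : ℕ) :
    primL T T (hφ.toL2 (n + 1)) = 0 := by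
  rw [primL_apply hT le_rfl, intervalIntegral_congr_L2 hT le_rfl (hφ.coeFn_toL2 (n + 1)),
    iteratedDeriv_succ, (hφ.iteratedDeriv n).integral_deriv,
    (hφ.iteratedDeriv n).eq_zero (by simp)]

/-! ### Assembling elements of `H^k_0` -/

theorem isWeakDeriv_iff {T : ℝ} {n : ℕ} {u v : L2 T} : IsWeakDeriv T n u v ↔
    ∀ φ : ℝ → ℝ, ∀ hφ : IsTest T φ,
      inner ℝ (hφ.toL2 n) u = (-1) ^ n * inner ℝ (hφ.toL2 0) v := by
  have e : ∀ (φ : ℝ → ℝ) (hφ : IsTest T φ) (m : ℕ) (w : L2 T),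
      inner ℝ (hφ.toL2 m) w = ∫ t in Ioo 0 T, w t * iteratedDeriv m φ t := by
    intro φ hφ m w
    rw [L2.inner_def]
    apply integral_congr_ae
    filter_upwards [hφ.coeFn_toL2 m] with t ht
    rw [ht]
    simp
  unfold IsWeakDeriv
  refine forall_congr' fun φ => forall_congr' fun hφ => ?_
  rw [e, e, iteratedDeriv_zero]

/-- Each weak derivative identity equates two continuous functionals, inner products with fixed test
functions. -/
theorem isClosed_sobolevH (k : ℕ) (T : ℝ) :
    IsClosed (SobolevH k T : Set (PiLp 2 (fun _ : Fin (k + 1) => L2 T))) := by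
  have : (SobolevH k T : Set (PiLp 2 (fun _ : Fin (k + 1) => L2 T))) =
      ⋂ (n : Fin (k + 1)) (φ : ℝ → ℝ) (hφ : IsTest T φ),
        {U | inner ℝ (hφ.toL2 (n : ℕ)) (U 0) =
          (-1) ^ (n : ℕ) * inner ℝ (hφ.toL2 0) (U n)} := by
    ext U
    simp only [mem_iInter, mem_ofPred_eq]
    exact forall_congr' fun n => isWeakDeriv_iff
  rw [this]
  refine isClosed_iInter fun n => isClosed_iInter fun φ => isClosed_iInter fun hφ => ?_
  refine isClosed_eq ?_ ?_
  · exact continuous_const.inner (PiLp.continuous_apply 2 _ 0)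
  · exact continuous_const.mul (continuous_const.inner (PiLp.continuous_apply 2 _ n))

theorem IsTest.isWeakDeriv {T : ℝ} (hT : 0 ≤ T) {φ : ℝ → ℝ} (hφ : IsTest T φ) (n : ℕ) :
    IsWeakDeriv T n (hφ.toL2 0) (hφ.toL2 n) := by
  have key : ∀ (n : ℕ) {φ ψ : ℝ → ℝ}, IsTest T φ → IsTest T ψ →
      ∫ t in Ioo 0 T, φ t * _root_.iteratedDeriv n ψ t =
        (-1) ^ n * ∫ t in Ioo 0 T, _root_.iteratedDeriv n φ t * ψ t := by
    intro n
    induction n with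
    | zero => intro φ ψ _ _; simp
    | succ n ih =>
      intro φ ψ hφ hψ
      rw [iteratedDeriv_succ', ih hφ hψ.deriv, iteratedDeriv_succ, pow_succ, mul_assoc]
      congr 1
      have h1 := (hφ.iteratedDeriv n)
      have := intervalIntegral.integral_mul_deriv_eq_deriv_mul (a := 0) (b := T)
        (fun t _ => ((h1.smooth.differentiable (by simp)) t).hasDerivAt)
        (fun t _ => ((hψ.smooth.differentiable (by simp)) t).hasDerivAt)
        (h1.deriv.smooth.continuous.intervalIntegrable _ _)
        (hψ.deriv.smooth.continuous.intervalIntegrable _ _)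
      rw [h1.eq_zero (t := 0) (by simp), h1.eq_zero (t := T) (by simp)] at this
      rw [intervalIntegral.integral_of_le hT, intervalIntegral.integral_of_le hT,
        integral_Ioc_eq_integral_Ioo, integral_Ioc_eq_integral_Ioo] at this
      rw [this]
      ring
  intro ψ hψ
  have e1 : ∫ t in Ioo 0 T, hφ.toL2 0 t * _root_.iteratedDeriv n ψ t =
      ∫ t in Ioo 0 T, φ t * _root_.iteratedDeriv n ψ t := by
    apply integral_congr_ae
    filter_upwards [hφ.coeFn_toL2 0] with t ht
    rw [ht, iteratedDeriv_zero]
  have e2 : ∫ t in Ioo 0 T, hφ.toL2 n t * ψ t =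
      ∫ t in Ioo 0 T, _root_.iteratedDeriv n φ t * ψ t := by
    apply integral_congr_ae
    filter_upwards [hφ.coeFn_toL2 n] with t ht
    rw [ht]
  rw [e1, e2, key n hφ hψ]

/-- The element of `H^k_0(0, T)` given by a test function. -/
theorem IsTest.exists_sobolevH {T : ℝ} (hT : 0 ≤ T) (k : ℕ) {φ : ℝ → ℝ} (hφ : IsTest T φ) :
    ∃ U : SobolevH k T, U ∈ testSubmodule k T ∧ ∀ n : Fin (k + 1), U.1 n = hφ.toL2 (n : ℕ) := by
  refine ⟨⟨WithLp.toLp 2 fun n : Fin (k + 1) => hφ.toL2 (n : ℕ), fun n => hφ.isWeakDeriv hT n⟩,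
    ⟨φ, hφ, ?_⟩, fun n => rfl⟩
  exact (hφ.coeFn_toL2 0).trans (by rw [iteratedDeriv_zero])

/-- A bounded linear map into `H^k_0(0, T)` from its components, when these are the sums of series
of derivatives of test functions. -/
theorem exists_clm_sobolevH0 {T : ℝ} (hT : 0 ≤ T) (k : ℕ) {E ι : Type*} [SeminormedAddCommGroup E]
    [NormedSpace ℝ E] (c : Fin (k + 1) → E →L[ℝ] L2 T)
    (hc : ∀ e, ∃ φ : ι → ℝ → ℝ, ∃ hφ : ∀ i, IsTest T (φ i), ∀ n : Fin (k + 1),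
      HasSum (fun i => (hφ i).toL2 (n : ℕ)) (c n e)) :
    ∃ U : E →L[ℝ] SobolevH0 k T, ∀ e n, SobolevH0.wderiv (U e) n = c n e := by
  let V : E →L[ℝ] PiLp 2 (fun _ : Fin (k + 1) => L2 T) :=
    ((PiLp.continuousLinearEquiv 2 ℝ (fun _ : Fin (k + 1) => L2 T)).symm :
      (Fin (k + 1) → L2 T) →L[ℝ] PiLp 2 (fun _ : Fin (k + 1) => L2 T)).comp
      (ContinuousLinearMap.pi c)
  have hV : ∀ e n, V e n = c n e := fun e n => rfl
  have hlim : ∀ e, ∃ φ : ι → SobolevH k T, (∀ i, φ i ∈ testSubmodule k T) ∧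
      HasSum (fun i => (φ i).1) (V e) := by
    intro e
    obtain ⟨φ, hφ, hs⟩ := hc e
    choose Φ hΦ1 hΦ2 using fun i => (hφ i).exists_sobolevH hT k
    refine ⟨Φ, hΦ1, ?_⟩
    have h1 : HasSum (fun i n => hφ i |>.toL2 ((n : Fin (k + 1)) : ℕ)) (fun n => c n e) :=
      Pi.hasSum.mpr hs
    have h2 := h1.mapL ((PiLp.continuousLinearEquiv 2 ℝ (fun _ : Fin (k + 1) => L2 T)).symm :
      (Fin (k + 1) → L2 T) →L[ℝ] PiLp 2 (fun _ : Fin (k + 1) => L2 T))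
    refine h2.congr_fun fun i => ?_
    ext1 n
    exact hΦ2 i n
  have hmem1 : ∀ e, V e ∈ SobolevH k T := by
    intro e
    obtain ⟨φ, -, hs⟩ := hlim e
    refine (isClosed_sobolevH k T).mem_of_tendsto hs (Eventually.of_forall fun s => ?_)
    exact Submodule.sum_mem _ fun i _ => (φ i).2
  have hmem2 : ∀ e, (⟨V e, hmem1 e⟩ : SobolevH k T) ∈ SobolevH0 k T := by
    intro e
    obtain ⟨φ, hφ, hs⟩ := hlim e
    -- Convergence in `H^k` is convergence of all the components in `L²`, so the partial sums
    -- already converge in the subspace.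
    have h3 : Tendsto (fun s : Finset ι => ∑ i ∈ s, φ i) atTop (𝓝 (⟨V e, hmem1 e⟩)) := by
      rw [tendsto_subtype_rng]
      simpa using! hs
    refine (Submodule.isClosed_topologicalClosure _).mem_of_tendsto h3
      (Eventually.of_forall fun s => ?_)
    exact Submodule.sum_mem _ fun i _ => Submodule.le_topologicalClosure _ (hφ i)
  exact ⟨(V.codRestrict (SobolevH k T) hmem1).codRestrict (SobolevH0 k T) hmem2, fun e n => rfl⟩

/-! ### Frequencies with a polynomial gap -/

/-- Strict monotonicity makes the finitely many exceptional gaps positive, so a smaller constant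
covers them. For `r ≥ 1`, the shift to `r + 1` costs a factor `2 ^ ε`; it avoids a zero base at `r =
0`. -/
theorem AsymptGapPoly.exists_uniform {ω : ℕ → ℝ} (hω : StrictMono ω) (h : AsymptGapPoly ω) :
    ∃ ε : ℝ, 0 < ε ∧ ∃ c : ℝ, 0 < c ∧ ∀ r : ℕ, c * ((r : ℝ) + 1) ^ ε ≤ ω (r + 1) - ω r := by
  obtain ⟨ε, hε, N₀, c, hc, h⟩ := h
  have hpos : ∀ r : ℕ, 0 < ((r : ℝ) + 1) ^ ε := fun r => by positivity
  have hfin : ∀ N : ℕ, ∃ c' : ℝ, 0 < c' ∧ ∀ r < N, c' * ((r : ℝ) + 1) ^ ε ≤ ω (r + 1) - ω r := by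
    intro N
    induction N with
    | zero => exact ⟨1, one_pos, by simp⟩
    | succ N ih =>
      obtain ⟨c', hc', ih⟩ := ih
      have hN : 0 < ω (N + 1) - ω N := sub_pos.mpr (hω (Nat.lt_succ_self N))
      refine ⟨min c' ((ω (N + 1) - ω N) / ((N : ℝ) + 1) ^ ε), lt_min hc' (div_pos hN (hpos N)),
        fun r hr => ?_⟩
      rcases Nat.lt_succ_iff_lt_or_eq.mp hr with hr | rfl
      · exact (mul_le_mul_of_nonneg_right (min_le_left _ _) (hpos r).le).trans (ih r hr)
      · rw [← le_div_iff₀ (hpos r)]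
        exact min_le_right _ _
  obtain ⟨c', hc', hfin⟩ := hfin (max N₀ 1)
  refine ⟨ε, hε, min c' (c * (2 ^ ε)⁻¹), lt_min hc' (by positivity), fun r => ?_⟩
  rcases lt_or_ge r (max N₀ 1) with hr | hr
  · exact (mul_le_mul_of_nonneg_right (min_le_left _ _) (hpos r).le).trans (hfin r hr)
  · refine (mul_le_mul_of_nonneg_right (min_le_right _ _) (hpos r).le).trans
      (le_trans ?_ (h r ((le_max_left _ _).trans hr)))
    have h1 : (1 : ℝ) ≤ r := by exact_mod_cast (le_max_right _ _).trans hr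
    have h2 : ((r : ℝ) + 1) ^ ε ≤ 2 ^ ε * (r : ℝ) ^ ε := by
      rw [← Real.mul_rpow (by norm_num) (by linarith)]
      exact Real.rpow_le_rpow (by linarith) (by linarith) hε.le
    rw [mul_assoc]
    gcongr
    rwa [inv_mul_le_iff₀ (by positivity)]

/-- The two-sided sequence `±ω_{j+1}`. -/
def twoSided (ω : ℕ → ℝ) (i : ℕ × Bool) : ℝ := if i.2 then ω (i.1 + 1) else -ω (i.1 + 1)

/-- Two distinct frequencies differ by at least the gap `ω (r + 1) - ω r` at the larger index `r`,
whatever their signs. The larger index is then bounded below by a geometric mean, to get a bound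
that factors and can be summed over pairs. -/
theorem sparseFreq_twoSided {ω : ℕ → ℝ} (hω : StrictMono ω) (h0 : ω 0 = 0)
    (h : AsymptGapPoly ω) : SparseFreq (twoSided ω) := by
  obtain ⟨ε, hε, c, hc, hgap⟩ := h.exists_uniform hω
  have hnn : ∀ j, 0 ≤ ω j := fun j => h0 ▸ hω.monotone (Nat.zero_le j)
  have h1 : 0 < ω 1 := h0 ▸ hω one_pos
  have hle1 : ∀ j, ω 1 ≤ ω (j + 1) := fun j => hω.monotone (by omega)
  have key : ∀ i j : ℕ × Bool, i ≠ j → i.1 ≤ j.1 →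
      c * ((j.1 : ℝ) + 1) ^ ε ≤ |twoSided ω i - twoSided ω j| := by
    rintro ⟨p, b⟩ ⟨r, b'⟩ hij hpr
    refine (hgap r).trans ?_
    change p ≤ r at hpr
    have e1 := hnn r
    have e2 := hnn (r + 1)
    have e3 := hnn (p + 1)
    by_cases hb : b = b'
    · subst hb
      have hlt : p < r := lt_of_le_of_ne hpr fun e => hij (by rw [e])
      have e4 : ω (p + 1) ≤ ω r := hω.monotone hlt
      cases b <;> simp only [twoSided, if_true, Bool.false_eq_true, if_false]
      · refine le_trans ?_ (le_abs_self _); linarith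
      · refine le_trans ?_ (neg_le_abs _); linarith
    · cases b <;> cases b' <;>
        simp only [twoSided, if_true, Bool.false_eq_true, if_false] at hb ⊢
      · exact absurd trivial hb
      · refine le_trans ?_ (neg_le_abs _); linarith
      · refine le_trans ?_ (le_abs_self _); linarith
      · exact absurd trivial hb
  have key2 : ∀ i j : ℕ × Bool, i ≠ j →
      c * (((i.1 : ℝ) + 1) * ((j.1 : ℝ) + 1)) ^ (ε / 2) ≤ |twoSided ω i - twoSided ω j| := by
    have aux : ∀ i j : ℕ × Bool, i ≠ j → i.1 ≤ j.1 →
        c * (((i.1 : ℝ) + 1) * ((j.1 : ℝ) + 1)) ^ (ε / 2) ≤ |twoSided ω i - twoSided ω j| := by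
      intro i j hij hle
      refine le_trans ?_ (key i j hij hle)
      have : (i.1 : ℝ) ≤ j.1 := by exact_mod_cast hle
      calc c * (((i.1 : ℝ) + 1) * ((j.1 : ℝ) + 1)) ^ (ε / 2)
          ≤ c * (((j.1 : ℝ) + 1) * ((j.1 : ℝ) + 1)) ^ (ε / 2) := by gcongr
        _ = c * ((j.1 : ℝ) + 1) ^ ε := by
          rw [Real.mul_rpow (by positivity) (by positivity), ← Real.rpow_add (by positivity),
            add_halves]
    intro i j hij
    rcases le_total i.1 j.1 with hle | hle
    · exact aux i j hij hle
    · rw [abs_sub_comm, mul_comm ((i.1 : ℝ) + 1)]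
      exact aux j i (Ne.symm hij) hle
  refine ⟨fun i j hij => ?_, ⟨ω 1, h1, fun i => ?_⟩, ⌈4 / ε⌉₊, ?_⟩
  · by_contra hne
    have := key2 i j hne
    rw [hij, sub_self, abs_zero] at this
    have : 0 < c * (((i.1 : ℝ) + 1) * ((j.1 : ℝ) + 1)) ^ (ε / 2) := by positivity
    linarith
  · unfold twoSided
    split_ifs
    · exact (hle1 _).trans (le_abs_self _)
    · exact (hle1 _).trans (by rw [abs_neg]; exact le_abs_self _)
  · set M := ⌈4 / ε⌉₊
    have hM : 2 ≤ ε / 2 * M := by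
      have : 4 / ε ≤ M := Nat.le_ceil _
      rw [div_le_iff₀ hε] at this
      linarith
    have hs1 : Summable fun j : ℕ => (((j : ℝ) + 1) ^ 2)⁻¹ := by
      have := (summable_nat_add_iff 1).mpr (Real.summable_nat_pow_inv.mpr one_lt_two)
      simpa using this
    have hs2 : Summable fun i : ℕ × Bool => (((i.1 : ℝ) + 1) ^ 2)⁻¹ := by
      have := hs1.mul_of_nonneg (Summable.of_finite (f := fun _ : Bool => (1 : ℝ)))
        (fun _ => by positivity) (fun _ => zero_le_one)
      simpa using this
    have hs3 := hs2.mul_of_nonneg hs2 (fun _ => by positivity) (fun _ => by positivity)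
    refine Summable.of_nonneg_of_le (fun p => ?_) (fun p => ?_) (hs3.mul_left ((c⁻¹) ^ M))
    · split_ifs <;> positivity
    · split_ifs with hp
      · positivity
      · set Q := ((p.1.1 : ℝ) + 1) * ((p.2.1 : ℝ) + 1) with hQ
        have hQ1 : 1 ≤ Q := by
          have a1 : (0 : ℝ) ≤ p.1.1 := by positivity
          have a2 : (0 : ℝ) ≤ p.2.1 := by positivity
          nlinarith
        have hQ0 : 0 < Q := by linarith
        calc (|twoSided ω p.1 - twoSided ω p.2|⁻¹) ^ M ≤ ((c * Q ^ (ε / 2))⁻¹) ^ M := by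
              gcongr
              exact key2 _ _ hp
          _ = (c⁻¹) ^ M * (Q ^ (ε / 2 * M))⁻¹ := by
              rw [mul_inv, mul_pow, inv_pow (Q ^ _), ← Real.rpow_mul_natCast hQ0.le]
          _ ≤ (c⁻¹) ^ M * (Q ^ (2 : ℝ))⁻¹ := by
              gcongr
          _ = _ := by
              rw [hQ, Real.rpow_two, mul_pow, mul_inv]

/-! ### A real test function of unit mass -/

theorem exists_unit_test {T : ℝ} (hT : 0 < T) : ∃ σ : ℝ → ℝ, IsTest T σ ∧
    ∫ t in Ioo 0 T, σ t * σ t = 1 := by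
  let f : ContDiffBump (T / 2) := ⟨T / 8, T / 4, by positivity, by linarith⟩
  have hsupp : tsupport f ⊆ Ioo 0 T := by
    rw [f.tsupport_eq, Real.closedBall_eq_Icc]
    intro t ht
    simp only [mem_Icc, f] at ht
    constructor <;> linarith [ht.1, ht.2]
  have hf : IsTest T f := ⟨f.contDiff, f.hasCompactSupport, hsupp⟩
  have hpos : 0 < ∫ t in Ioo 0 T, f t * f t := by
    rw [setIntegral_eq_integral_of_forall_compl_eq_zero
      fun t ht => by rw [hf.eq_zero ht, mul_zero]]
    refine (f.continuous.mul f.continuous).integral_pos_of_hasCompactSupport_nonneg_nonzero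
      f.hasCompactSupport.mul_left (fun t => mul_self_nonneg _) (x := T / 2) ?_
    have : f (T / 2) = 1 := f.one_of_mem_closedBall (Metric.mem_closedBall_self (by positivity))
    simp [this]
  set A := ∫ t in Ioo 0 T, f t * f t
  refine ⟨(Real.sqrt A)⁻¹ • (f : ℝ → ℝ), hf.smul _, ?_⟩
  have : ∀ t, ((Real.sqrt A)⁻¹ • (f : ℝ → ℝ)) t * ((Real.sqrt A)⁻¹ • (f : ℝ → ℝ)) t =
      A⁻¹ * (f t * f t) := by
    intro t
    simp only [Pi.smul_apply, smul_eq_mul]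
    rw [mul_mul_mul_comm, ← mul_inv, Real.mul_self_sqrt hpos.le]
  simp only [this]
  rw [integral_const_mul]
  exact inv_mul_cancel₀ hpos.ne'

/-! ### The solution operator for data vanishing at the zero frequency -/

theorem summable_two_copies {f : ℕ → ℂ} (hf : Summable fun j => ‖f j‖ ^ 2) :
    (Summable fun i : ℕ × Bool => ‖f (i.1 + 1)‖ ^ 2) ∧
      ∑' i : ℕ × Bool, ‖f (i.1 + 1)‖ ^ 2 ≤ 2 * ∑' j, ‖f j‖ ^ 2 := by
  have h1 : Summable fun j => ‖f (j + 1)‖ ^ 2 :=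
    (summable_nat_add_iff (f := fun j => ‖f j‖ ^ 2) 1).mpr hf
  have hB : HasSum (fun _ : Bool => (1 : ℝ)) 2 := by
    simpa using hasSum_fintype (fun _ : Bool => (1 : ℝ))
  have h2 := h1.mul_of_nonneg hB.summable (fun _ => by positivity) (fun _ => zero_le_one)
  have h3 := h1.hasSum.mul hB h2
  simp only [mul_one] at h2 h3
  refine ⟨h2, ?_⟩
  rw [h3.tsum_eq, mul_comm]
  have := hf.sum_add_tsum_nat_add 1
  simp only [Finset.sum_range_one] at this
  nlinarith [sq_nonneg ‖f 0‖]

theorem memℓp_of_two_copies {f : ℕ → ℂ} (hf : Summable fun j => ‖f j‖ ^ 2) {w : ℕ × Bool → ℂ}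
    (hw : ∀ i, ‖w i‖ ≤ ‖f (i.1 + 1)‖) : Memℓp w 2 := by
  refine memℓp_gen ?_
  simp only [ENNReal.toReal_ofNat, Real.rpow_two]
  exact (summable_two_copies hf).1.of_nonneg_of_le (fun _ => by positivity) fun i =>
    pow_le_pow_left₀ (norm_nonneg _) (hw i) 2

theorem norm_le_of_two_copies {f : ℕ → ℂ} (hf : Summable fun j => ‖f j‖ ^ 2)
    {w : Ell2 (ℕ × Bool)} (hw : ∀ i, ‖w i‖ ≤ ‖f (i.1 + 1)‖) :
    ‖w‖ ≤ 2 * Real.sqrt (∑' j, ‖f j‖ ^ 2) := by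
  obtain ⟨h1, h2⟩ := summable_two_copies hf
  have h0 : 0 ≤ ∑' j, ‖f j‖ ^ 2 := tsum_nonneg fun _ => by positivity
  refine lp.norm_le_of_tsum_le (by norm_num) (by positivity) ?_
  simp only [ENNReal.toReal_ofNat, Real.rpow_two]
  rw [mul_pow, Real.sq_sqrt h0]
  have h3 : ∑' i : ℕ × Bool, ‖w i‖ ^ 2 ≤ ∑' i : ℕ × Bool, ‖f (i.1 + 1)‖ ^ 2 := by
    have hle := fun i => pow_le_pow_left₀ (norm_nonneg _) (hw i) 2
    exact Summable.tsum_le_tsum hle (h1.of_nonneg_of_le (fun _ => by positivity) hle) h1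
  linarith

theorem abs_twoSided {ω : ℕ → ℝ} (hω : StrictMono ω) (h0 : ω 0 = 0) (i : ℕ × Bool) :
    |twoSided ω i| = ω (i.1 + 1) := by
  have : 0 < ω (i.1 + 1) := h0 ▸ hω (Nat.succ_pos _)
  unfold twoSided
  split_ifs
  · exact abs_of_pos this
  · rw [abs_neg, abs_of_pos this]

/-- The data at the frequencies `±ω_{j+1}`: `d_{j+1}` and its conjugate. -/
def twoSidedData {ω : ℕ → ℝ} {k : ℕ} (d : HSeq ω k) (i : ℕ × Bool) : ℂ :=
  if i.2 then d.seq (i.1 + 1) else (starRingEnd ℂ) (d.seq (i.1 + 1))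

theorem norm_twoSidedData {ω : ℕ → ℝ} {k : ℕ} (d : HSeq ω k) (i : ℕ × Bool) :
    ‖twoSidedData d i‖ = ‖d.seq (i.1 + 1)‖ := by
  unfold twoSidedData
  split_ifs
  · rfl
  · exact RCLike.norm_conj _

/-- The exponents add up to `-(s - q) + s - (k + 1) = q - (k + 1)` with `s = 2k + 1`: order `q` for
the antiderivative is order `q - (k + 1)` for the solution. -/
theorem norm_weighted_data {ω : ℕ → ℝ} (hω : StrictMono ω) (h0 : ω 0 = 0) {k : ℕ} (d : HSeq ω k)
    {q : ℕ} (hq : q ≤ 2 * k + 1) (i : ℕ × Bool) :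
    ‖((twoSided ω i : ℂ) ^ (2 * k + 1 - q))⁻¹ * ((twoSided ω i : ℂ) ^ (2 * k + 1) *
      ((-(Complex.I * (twoSided ω i : ℂ))) ^ (k + 1))⁻¹ * twoSidedData d i)‖ =
    ‖(hWeight ω ((q : ℤ) - (k + 1)) (i.1 + 1) : ℂ) * d.seq (i.1 + 1)‖ := by
  have hpos : 0 < ω (i.1 + 1) := h0 ▸ hω (Nat.succ_pos _)
  simp only [norm_mul, norm_inv, norm_pow, norm_neg, Complex.norm_I, one_mul, Complex.norm_real,
    Real.norm_eq_abs, abs_twoSided hω h0, norm_twoSidedData, hWeight, Nat.succ_ne_zero, if_false,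
    zero_add, abs_of_pos (zpow_pos hpos _)]
  rw [← mul_assoc, ← mul_assoc]
  congr 1
  rw [← zpow_natCast, ← zpow_natCast, ← zpow_natCast, ← zpow_neg, ← zpow_neg,
    ← zpow_add₀ hpos.ne', ← zpow_add₀ hpos.ne']
  congr 1
  push_cast [Nat.cast_sub hq]
  ring

theorem CTest.const_smul {T : ℝ} {g : ℝ → ℂ} (hg : CTest T g) (c : ℂ) :
    CTest T fun t => g t * c :=
  hg.mul contDiff_const

theorem CTest.reL_smul_toL2 {T : ℝ} {g : ℝ → ℂ} (hg : CTest T g) (c : ℂ) (q : ℕ) :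
    reL T (c • (hg.iteratedDeriv q).toL2) = (hg.const_smul c).re.toL2 q := by
  apply Lp.ext
  filter_upwards [coeFn_reL (c • (hg.iteratedDeriv q).toL2),
    Lp.coeFn_smul c (hg.iteratedDeriv q).toL2, (hg.iteratedDeriv q).coeFn_toL2,
    (hg.const_smul c).re.coeFn_toL2 q] with t h1 h2 h3 h4
  rw [h1, h2, h4, Pi.smul_apply, h3, (hg.const_smul c).iteratedDeriv_re, smul_eq_mul]
  have : (fun t => g t * c) = fun t => c * g t := by funext t; ring
  simp only [this, iteratedDeriv_const_mul_field]

theorem IsTest.toL2_iteratedDeriv {T : ℝ} {φ : ℝ → ℝ} (hφ : IsTest T φ) (m n : ℕ) :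
    (hφ.iteratedDeriv m).toL2 n = hφ.toL2 (m + n) := by
  unfold IsTest.toL2
  congr 1
  rw [iteratedDeriv_eq_iterate, iteratedDeriv_eq_iterate, iteratedDeriv_eq_iterate,
    ← Function.iterate_add_apply, add_comm]

theorem realMoment_zero {T : ℝ} (hT : 0 ≤ T) (u : L2 T) :
    realMoment T 0 u = (primL T T u : ℂ) := by
  rw [realMoment, primL_apply hT le_rfl, ← intervalIntegral.integral_ofReal]
  simp

/-- The solution of the moment problem at the nonzero frequencies, with all the moments
`∫₀ᵀ (T - t)^n u(t) dt`, `0 ≤ n ≤ k`, equal to zero. -/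
theorem exists_solution_operator {T : ℝ} (hT : 0 < T) (k : ℕ) {ω : ℕ → ℝ} (hω : StrictMono ω)
    (h0 : ω 0 = 0) (hgap : AsymptGapPoly ω) :
    ∃ U : HSeq ω k →L[ℝ] SobolevH0 k T, ∃ C : ℝ, 0 ≤ C ∧ ∀ d : HSeq ω k,
      (∀ j, realMoment T (ω (j + 1)) (SobolevH0.wderiv (U d) 0) = d.seq (j + 1)) ∧
      (∀ n ≤ k, primL T T ((volterra hT.le ^ n : L2 T →L[ℝ] L2 T)
        (SobolevH0.wderiv (U d) 0)) = 0) ∧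
      (∀ m : Fin (k + 1), ‖SobolevH0.wderiv (U d) m‖ ≤ C * hNorm ω ((m : ℕ) : ℤ) d.seq) ∧
      (∀ n ≤ k + 1, ‖(volterra hT.le ^ n : L2 T →L[ℝ] L2 T) (SobolevH0.wderiv (U d) 0)‖ ≤
        C * hNorm ω (-(n : ℤ)) d.seq) := by
  have hsp := sparseFreq_twoSided hω h0 hgap
  set lam := twoSided ω with hlam
  obtain ⟨σ, hσ, hσ1⟩ := exists_unit_test hT
  have hcσ : CTest T fun t => (σ t : ℂ) :=
    ⟨Complex.ofRealCLM.contDiff.comp hσ.smooth,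
      (tsupport_comp_subset (g := fun x : ℝ => (x : ℂ)) Complex.ofReal_zero σ).trans hσ.supp⟩
  have hρ := hcσ.mul hcσ.smooth
  have hone : hat T (fun t => (σ t : ℂ) * σ t) 0 = 1 := by
    unfold hat
    rw [← Complex.ofReal_one, ← hσ1, ← integral_complex_ofReal]
    simp
  -- The solution is a `(k + 1)`-st derivative and has `k` derivatives of its own, so orders up to
  -- `2k + 1` are needed. Up to unimodular factors, the data of weight `s` are `λ^k d`, in `ℓ²` by
  -- assumption.
  set s := 2 * k + 1 with hs
  obtain ⟨y, hy, hW⟩ := hsp.exists_solver hT.le hcσ (fun t => Complex.conj_ofReal _) hρ hone s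
  choose! W hWsum Cq hCq hWle using hW
  set zc : HSeq ω k → ℕ × Bool → ℂ := fun d i => (lam i : ℂ) ^ s *
    ((-(Complex.I * (lam i : ℂ))) ^ (k + 1))⁻¹ * twoSidedData d i with hzc
  have hzle : ∀ d i, ‖zc d i‖ ≤ ‖(hWeight ω (k : ℤ) (i.1 + 1) : ℂ) * d.seq (i.1 + 1)‖ := by
    intro d i
    have := norm_weighted_data hω h0 d (q := s) le_rfl i
    rw [← hs, ← hlam, Nat.sub_self, pow_zero, inv_one, one_mul] at this
    refine this.le.trans_eq ?_
    congr 4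
    rw [hs]; push_cast; ring
  have hmem : ∀ d, Memℓp (zc d) 2 := fun d =>
    memℓp_of_two_copies (d.summable hω h0 le_rfl) (hzle d)
  have hadd : ∀ d e : HSeq ω k, ∀ i, twoSidedData (d + e) i =
      twoSidedData d i + twoSidedData e i := by
    intro d e i
    unfold twoSidedData
    split_ifs
    · rfl
    · exact map_add (starRingEnd ℂ) (d.seq (i.1 + 1)) (e.seq (i.1 + 1))
  have hsmul : ∀ (r : ℝ) (d : HSeq ω k) i, twoSidedData (r • d) i = r * twoSidedData d i := by
    intro r d i
    unfold twoSidedData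
    split_ifs
    · exact Complex.real_smul
    · change (starRingEnd ℂ) (r • d.seq (i.1 + 1)) = _
      rw [Complex.real_smul, map_mul, Complex.conj_ofReal]
  let Z₀ : HSeq ω k →ₗ[ℝ] Ell2 (ℕ × Bool) :=
    { toFun := fun d => ⟨zc d, hmem d⟩
      map_add' := fun d e => by
        ext i
        change zc (d + e) i = zc d i + zc e i
        simp only [hzc, hadd, mul_add]
      map_smul' := fun r d => by
        ext i
        change zc (r • d) i = r • zc d i
        simp only [hzc, hsmul, Complex.real_smul]
        ring }
  let Z : HSeq ω k →L[ℝ] Ell2 (ℕ × Bool) := Z₀.mkContinuous 2 fun d => by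
    rw [HSeq.norm_eq]
    exact norm_le_of_two_copies (d.summable hω h0 le_rfl) (hzle d)
  have hZ : ∀ d i, Z d i = zc d i := fun d i => rfl
  let V : ℕ → HSeq ω k →L[ℝ] L2 T := fun q =>
    (reL T).comp (((W q).restrictScalars ℝ).comp Z)
  have hV : ∀ q d, V q d = reL T (W q (Z d)) := fun q d => rfl
  have hχ := fun (d : HSeq ω k) (i : ℕ × Bool) =>
    ((hρ.mode (lam i)).const_smul (((lam i : ℂ) ^ s)⁻¹ * y (Z d) i)).re
  have hVsum : ∀ q ≤ s, ∀ d, HasSum (fun i => (hχ d i).toL2 q) (V q d) := by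
    intro q hq d
    refine ((hWsum q hq (Z d)).mapL (reL T)).congr_fun fun i => ?_
    exact ((hρ.mode (lam i)).reL_smul_toL2 _ q).symm
  set C := 2 * ∑ q ∈ Finset.range (s + 1), Cq q with hC
  have hCq0 : ∀ q ∈ Finset.range (s + 1), 0 ≤ Cq q := fun q hq =>
    hCq q (Nat.lt_succ_iff.mp (Finset.mem_range.mp hq))
  have hVle : ∀ q ≤ s, ∀ d : HSeq ω k, ‖V q d‖ ≤ C * hNorm ω ((q : ℤ) - (k + 1)) d.seq := by
    intro q hq d
    have hsum := d.summable hω h0 (m := (q : ℤ) - (k + 1)) (by omega)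
    have hle : ∀ i, ‖((lam i : ℂ) ^ (s - q))⁻¹ * zc d i‖ ≤
        ‖(hWeight ω ((q : ℤ) - (k + 1)) (i.1 + 1) : ℂ) * d.seq (i.1 + 1)‖ := fun i =>
      (norm_weighted_data hω h0 d hq i).le
    let w : Ell2 (ℕ × Bool) := ⟨_, memℓp_of_two_copies hsum hle⟩
    have h1 := hWle q hq (Z d) w fun i => rfl
    have h2 : ‖w‖ ≤ 2 * hNorm ω ((q : ℤ) - (k + 1)) d.seq := norm_le_of_two_copies hsum hle
    have h3 : Cq q ≤ ∑ q ∈ Finset.range (s + 1), Cq q :=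
      Finset.single_le_sum hCq0 (Finset.mem_range.mpr (Nat.lt_succ_of_le hq))
    have h4 : 0 ≤ hNorm ω ((q : ℤ) - (k + 1)) d.seq := Real.sqrt_nonneg _
    calc ‖V q d‖ ≤ Cq q * ‖w‖ := (norm_reL_le _).trans h1
      _ ≤ Cq q * (2 * hNorm ω ((q : ℤ) - (k + 1)) d.seq) :=
        mul_le_mul_of_nonneg_left h2 (hCq q hq)
      _ ≤ (∑ q ∈ Finset.range (s + 1), Cq q) * (2 * hNorm ω ((q : ℤ) - (k + 1)) d.seq) := by
        gcongr
      _ = _ := by rw [hC]; ring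
  have hJ : ∀ q, q + 1 ≤ s → ∀ d, volterra hT.le (V (q + 1) d) = V q d := by
    intro q hq d
    refine HasSum.unique ((hVsum (q + 1) hq d).mapL (volterra hT.le))
      ((hVsum q (by omega) d).congr_fun fun i => ?_)
    exact (hχ d i).volterra_toL2 hT.le q
  have hI : ∀ q, q + 1 ≤ s → ∀ d, primL T T (V (q + 1) d) = 0 := by
    intro q hq d
    refine ((hVsum (q + 1) hq d).mapL (primL T T)).unique (hasSum_zero.congr_fun fun i => ?_)
    exact (hχ d i).primL_toL2 hT.le q
  have hJn : ∀ n ≤ k + 1, ∀ d,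
      (volterra hT.le ^ n : L2 T →L[ℝ] L2 T) (V (k + 1) d) = V (k + 1 - n) d := by
    intro n
    induction n with
    | zero => intro _ d; rfl
    | succ n ih =>
      intro hn d
      rw [pow_succ']
      change volterra hT.le ((volterra hT.le ^ n : L2 T →L[ℝ] L2 T) (V (k + 1) d)) = _
      rw [ih (by omega), show k + 1 - n = (k + 1 - (n + 1)) + 1 by omega]
      exact hJ _ (by omega) d
  -- Differentiating `k + 1` times multiplies the moments by `(-iλ)^{k+1}`, which cancels the
  -- inverse power put in `zc`.
  have hmom : ∀ d l, momentL T (lam l) (W (k + 1) (Z d)) = twoSidedData d l := by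
    intro d l
    have hl : (lam l : ℂ) ≠ 0 := by exact_mod_cast hsp.ne_zero l
    have h1 := (hWsum (k + 1) (by omega) (Z d)).mapL (momentL T (lam l))
    have h2 := (hy (Z d) l).mul_left ((-(Complex.I * (lam l : ℂ))) ^ (k + 1))
    rw [hZ] at h2
    have h3 : (-(Complex.I * (lam l : ℂ))) ^ (k + 1) ≠ 0 :=
      pow_ne_zero _ (neg_ne_zero.mpr (mul_ne_zero Complex.I_ne_zero hl))
    refine (h1.unique (h2.congr_fun fun i => ?_)).trans ?_
    · rw [map_smul, momentL_toL2, hat_iteratedDeriv hT.le (hρ.mode _), hat_mode, smul_eq_mul]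
      ring
    · simp only [hzc]
      field_simp
  have hφsum : ∀ (d : HSeq ω k) (n : Fin (k + 1)),
      HasSum (fun i => ((hχ d i).iteratedDeriv (k + 1)).toL2 n) (V (k + 1 + n) d) := fun d n =>
    (hVsum _ (by omega) d).congr_fun fun i => (hχ d i).toL2_iteratedDeriv (k + 1) n
  clear_value V
  obtain ⟨U, hU⟩ := exists_clm_sobolevH0 hT.le k (fun n : Fin (k + 1) => V (k + 1 + n))
    (fun d => ⟨_, fun i => (hχ d i).iteratedDeriv (k + 1), hφsum d⟩)
  have hU0 : ∀ d, SobolevH0.wderiv (U d) 0 = V (k + 1) d := fun d => hU d 0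
  refine ⟨U, C, mul_nonneg zero_le_two (Finset.sum_nonneg hCq0), fun d => ⟨fun j => ?_,
    fun n hn => ?_, fun m => ?_, fun n hn => ?_⟩⟩
  · rw [hU0, hV, realMoment_reL hT.le]
    have h1 := hmom d (j, true)
    have h2 := hmom d (j, false)
    simp only [hlam, twoSided, twoSidedData, if_true, Bool.false_eq_true, if_false] at h1 h2
    rw [h1, h2, Complex.conj_conj, add_self_div_two]
  · rw [hU0, hJn n (by omega), show k + 1 - n = (k - n) + 1 by omega]
    exact hI _ (by omega) d
  · rw [hU]
    refine (hVle (k + 1 + m) (by omega) d).trans_eq ?_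
    congr 2
    push_cast
    ring
  · rw [hU0, hJn n hn]
    refine (hVle (k + 1 - n) (by omega) d).trans_eq ?_
    congr 2
    push_cast [Nat.cast_sub hn]
    ring

/-! ### The component at the zero frequency -/

theorem IsTest.mul {T : ℝ} {φ ψ : ℝ → ℝ} (hφ : IsTest T φ) (hψ : IsTest T ψ) :
    IsTest T fun t => φ t * ψ t :=
  ⟨hφ.smooth.mul hψ.smooth, hφ.compact.mul_right,
    (tsupport_mul_subset_left (f := φ) (g := ψ)).trans hφ.supp⟩

theorem IsTest.toL2_add_smul {T : ℝ} {φ ψ : ℝ → ℝ} (hφ : IsTest T φ) (hψ : IsTest T ψ) (r : ℝ) :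
    (hφ.add (hψ.smul r)).toL2 0 = hφ.toL2 0 + r • hψ.toL2 0 := by
  apply Lp.ext
  filter_upwards [(hφ.add (hψ.smul r)).coeFn_toL2 0, hφ.coeFn_toL2 0, hψ.coeFn_toL2 0,
    Lp.coeFn_add (hφ.toL2 0) (r • hψ.toL2 0), Lp.coeFn_smul r (hψ.toL2 0)] with t h1 h2 h3 h4 h5
  rw [h1, h4, Pi.add_apply, h5, Pi.smul_apply, h2, h3]
  simp

theorem IsTest.volterra_pow_toL2 {T : ℝ} (hT : 0 ≤ T) {φ : ℝ → ℝ} (hφ : IsTest T φ) (n m : ℕ) :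
    (volterra hT ^ n : L2 T →L[ℝ] L2 T) (hφ.toL2 (m + n)) = hφ.toL2 m := by
  induction n with
  | zero => rfl
  | succ n ih =>
    rw [pow_succ]
    change (volterra hT ^ n : L2 T →L[ℝ] L2 T) (volterra hT (hφ.toL2 (m + n + 1))) = _
    rw [hφ.volterra_toL2, ih]

/-- A test function with `∫₀ᵀ w = 1` whose further iterated primitives of order at most `k + 1`
vanish at `T`. -/
theorem exists_profile {T : ℝ} (hT : 0 < T) (k : ℕ) : ∃ w : ℝ → ℝ, ∃ hw : IsTest T w,
    ∀ n ≤ k, primL T T ((volterra hT.le ^ n : L2 T →L[ℝ] L2 T) (hw.toL2 0)) =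
      if n = 0 then 1 else 0 := by
  obtain ⟨σ, hσ, hσ1⟩ := exists_unit_test hT
  have hρ := hσ.mul hσ
  have hρ1 : primL T T (hρ.toL2 0) = 1 := by
    rw [primL_apply hT.le le_rfl, intervalIntegral_congr_L2 hT.le le_rfl (hρ.coeFn_toL2 0),
      intervalIntegral.integral_of_le hT.le, integral_Ioc_eq_integral_Ioo, iteratedDeriv_zero, hσ1]
  induction k with
  | zero =>
    refine ⟨_, hρ, fun n hn => ?_⟩
    obtain rfl : n = 0 := by omega
    simpa using hρ1
  | succ k ih =>
    obtain ⟨w, hw, ih⟩ := ih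
    set c := primL T T ((volterra hT.le ^ (k + 1) : L2 T →L[ℝ] L2 T) (hw.toL2 0))
    -- The correction is a `(k + 1)`-st derivative: its earlier primitives vanish at `T`, and its
    -- next one is `∫ ρ = 1`, so `-c` times it repairs only the new condition.
    have hψ := hρ.iteratedDeriv (k + 1)
    refine ⟨_, hw.add (hψ.smul (-c)), fun n hn => ?_⟩
    rw [hw.toL2_add_smul hψ, map_add, map_smul, map_add, map_smul,
      hρ.toL2_iteratedDeriv, add_zero]
    rcases Nat.lt_or_ge n (k + 1) with h | h
    · rw [ih n (by omega)]
      have e : k + 1 = (k - n + 1) + n := by omega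
      rw [e, hρ.volterra_pow_toL2, hρ.primL_toL2 hT.le, smul_zero, add_zero]
    · obtain rfl : n = k + 1 := by omega
      have := hρ.volterra_pow_toL2 hT.le (k + 1) 0
      rw [zero_add] at this
      rw [this, hρ1]
      simp [c]

theorem IsTest.realMoment_toL2 {T : ℝ} (hT : 0 ≤ T) {w : ℝ → ℝ} (hw : IsTest T w) (x : ℝ) :
    realMoment T x (hw.toL2 0) = hat T (fun t => (w t : ℂ)) x := by
  rw [realMoment_eq hT, hat]
  apply integral_congr_ae
  filter_upwards [hw.coeFn_toL2 0] with t ht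
  rw [ht, iteratedDeriv_zero]

/-- The sequence of the moments of a test function belongs to every `h^{2k}_{ω,r}`. -/
theorem IsTest.exists_moment_seq {T : ℝ} (hT : 0 ≤ T) {w : ℝ → ℝ} (hw : IsTest T w) {ω : ℕ → ℝ}
    (hω : StrictMono ω) (h0 : ω 0 = 0) (hgap : AsymptGapPoly ω) (k : ℕ) :
    ∃ c : HSeq ω k, ∀ j, c.seq j = realMoment T (ω j) (hw.toL2 0) := by
  have hcw : CTest T fun t => (w t : ℂ) :=
    ⟨Complex.ofRealCLM.contDiff.comp hw.smooth,
      (tsupport_comp_subset (g := fun x : ℝ => (x : ℂ)) Complex.ofReal_zero w).trans hw.supp⟩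
  have hpos : ∀ j, 0 < ω (j + 1) := fun j => h0 ▸ hω (Nat.succ_pos _)
  obtain ⟨M, hM⟩ := (sparseFreq_twoSided hω h0 hgap).sum
  have hM' : Summable fun j => ((2 * ω (j + 1))⁻¹) ^ M := by
    -- The pairs `(ω_{j+1}, -ω_{j+1})` are off-diagonal with difference `2ω_{j+1}`, so the
    -- sparseness sum also controls inverse powers of the frequencies.
    have hi : Function.Injective fun j : ℕ => (((j, true), (j, false)) : (ℕ × Bool) × (ℕ × Bool)) :=
      fun a b hab => by simpa using hab
    refine (hM.comp_injective hi).congr fun j => ?_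
    have e : |ω (j + 1) - -ω (j + 1)| = 2 * ω (j + 1) := by
      rw [sub_neg_eq_add, ← two_mul, abs_of_pos (by linarith [hpos j])]
    rw [← e]
    simp [twoSided]
  have hsum : ∀ q : ℕ, Summable fun j =>
      ‖((ω (j + 1) : ℂ) ^ q) * realMoment T (ω (j + 1)) (hw.toL2 0)‖ := by
    intro q
    obtain ⟨C, hC, hd⟩ := hcw.hat_decay hT (q + M)
    refine Summable.of_nonneg_of_le (fun _ => norm_nonneg _) (fun j => ?_)
      (hM'.mul_left (C * 2 ^ M))
    have hp := hpos j
    have h1 := hd (ω (j + 1))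
    rw [hw.realMoment_toL2 hT, norm_mul, norm_pow, Complex.norm_real, Real.norm_eq_abs]
    rw [abs_of_pos hp] at h1 ⊢
    rw [mul_inv, mul_pow, inv_pow, mul_assoc, mul_inv_cancel_left₀ (by positivity), inv_pow,
      ← div_eq_mul_inv, le_div_iff₀ (by positivity)]
    refine le_trans ?_ h1
    rw [pow_add, mul_right_comm]
    gcongr <;> linarith
  have hmem : ∀ q : ℕ, Memℓp (fun j => (hWeight ω (q : ℤ) j : ℂ) *
      realMoment T (ω j) (hw.toL2 0)) 2 := by
    intro q
    refine Memℓp.of_exponent_ge (q := 1) (memℓp_gen ?_) one_le_two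
    simp only [ENNReal.toReal_one, Real.rpow_one]
    rw [← summable_nat_add_iff 1]
    refine (hsum q).congr fun j => ?_
    simp [hWeight]
  have hmem0 : Memℓp (fun j => realMoment T (ω j) (hw.toL2 0)) 2 := by
    -- The weight of order `0` is `2` at `j = 0` and `1` elsewhere, hence at least `1`.
    refine (hmem 0).mono' fun j => ?_
    rw [norm_mul]
    refine le_mul_of_one_le_left (norm_nonneg _) ?_
    rw [Complex.norm_real, Real.norm_eq_abs]
    unfold hWeight
    split_ifs <;> norm_num
  refine ⟨(⟨fun j => realMoment T (ω j) (hw.toL2 0), ?_, hmem0, hmem k⟩ : hSubmodule ω k),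
    fun j => rfl⟩
  change (realMoment T (ω 0) (hw.toL2 0)).im = 0
  rw [h0, realMoment_zero hT, Complex.ofReal_im]

/-- The weight at `j = 0` is at least `1` for every order, so each norm, of either sign, controls
the zero mode. -/
theorem HSeq.abs_re_zero_le {ω : ℕ → ℝ} {k : ℕ} (hω : StrictMono ω) (h0 : ω 0 = 0)
    (d : HSeq ω k) {m : ℤ} (hm : m ≤ k) : |(d.seq 0).re| ≤ hNorm ω m d.seq := by
  refine (Complex.abs_re_le_norm _).trans (Real.le_sqrt_of_sq_le ?_)
  refine le_trans ?_ ((d.summable hω h0 hm).le_tsum 0 fun _ _ => by positivity)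
  rw [norm_mul, mul_pow]
  refine le_mul_of_one_le_left (by positivity) (one_le_pow₀ ?_)
  rw [Complex.norm_real, Real.norm_eq_abs]
  refine le_trans ?_ (le_abs_self _)
  have : 0 ≤ ω 0 ^ m := zpow_nonneg h0.ge m
  simp only [hWeight, if_true]
  linarith

/-- The coordinate `d ↦ d_0`. -/
theorem HSeq.exists_zero_coord {ω : ℕ → ℝ} {k : ℕ} (hω : StrictMono ω) (h0 : ω 0 = 0) :
    ∃ L : HSeq ω k →L[ℝ] ℝ, ∀ d, L d = (d.seq 0).re := by
  let L₀ : HSeq ω k →ₗ[ℝ] ℝ :=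
    { toFun := fun d => (d.seq 0).re
      map_add' := fun _ _ => rfl
      map_smul' := fun r d => by
        change (r • d.seq 0).re = r • (d.seq 0).re
        simp }
  refine ⟨L₀.mkContinuous 1 fun d => ?_, fun d => rfl⟩
  rw [one_mul, HSeq.norm_eq]
  exact d.abs_re_zero_le hω h0 le_rfl

end MomentProblem
end

/-! ### The moment problem with all frequencies -/

theorem theorem3p9 (T : ℝ) (hT : 0 < T) (k : ℕ) (hk : 1 ≤ k)
    (ω : ℕ → ℝ) (hω : StrictMono ω) (hω0 : ω 0 = 0) (hgap : MomentProblem.AsymptGapPoly ω) :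
    ∃ C : ℝ, 0 < C ∧
    ∃ M : MomentProblem.HSeq ω k →L[ℝ] MomentProblem.SobolevH0 k T,
    ∀ d : MomentProblem.HSeq ω k,
      -- the moment problem
      (∀ j : ℕ, ∫ t in (0 : ℝ)..T,
        ((MomentProblem.SobolevH0.toFun (M d) t : ℝ) : ℂ) *
          Complex.exp (Complex.I * (ω j : ℂ) * (t : ℂ)) = d.seq j) ∧
      -- the boundary conditions
      (∀ n : ℕ, 2 ≤ n → n ≤ k + 1 → MomentProblem.iterPrim (MomentProblem.SobolevH0.toFun (M d)) n T = 0) ∧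
      -- the estimates of order `0 ≤ m ≤ k`
      (∀ m : Fin (k + 1),
        MomentProblem.SobolevH0.posNorm (M d) m ≤ C * MomentProblem.hNorm ω ((m : ℕ) : ℤ) d.seq) ∧
      -- the estimates of order `-n`, `1 ≤ n ≤ k + 1`
      (∀ n : ℕ, 1 ≤ n → n ≤ k + 1 →
        MomentProblem.negNorm T n (MomentProblem.SobolevH0.toFun (M d)) ≤ C * MomentProblem.hNorm ω (-(n : ℤ)) d.seq) := by
  open MomentProblem in
  obtain ⟨U, C, hC, hU⟩ := exists_solution_operator hT k hω hω0 hgap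
  obtain ⟨w, hw, hwn⟩ := exists_profile hT k
  obtain ⟨c, hc⟩ := hw.exists_moment_seq hT.le hω hω0 hgap k
  obtain ⟨L, hL⟩ := HSeq.exists_zero_coord (k := k) hω hω0
  obtain ⟨W, hWtest, hW⟩ := hw.exists_sobolevH hT.le k
  let W₀ : SobolevH0 k T := ⟨W, Submodule.le_topologicalClosure _ hWtest⟩
  have hW₀ : SobolevH0.wderiv W₀ 0 = hw.toL2 0 := hW 0
  -- Since `U c` reproduces the moments of `w` at the nonzero frequencies and has zero mean, `v` has
  -- mean `1` and no other moment.
  let v : SobolevH0 k T := W₀ - U c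
  have hv : ∀ n, SobolevH0.wderiv v n = SobolevH0.wderiv W₀ n - SobolevH0.wderiv (U c) n :=
    fun n => rfl
  let M : HSeq ω k →L[ℝ] SobolevH0 k T := U + L.smulRight v
  have hM : ∀ d n, SobolevH0.wderiv (M d) n =
      SobolevH0.wderiv (U d) n + (d.seq 0).re • SobolevH0.wderiv v n := by
    intro d n
    rw [← hL]
    rfl
  have hvol : ∀ d n, (volterra hT.le ^ n : L2 T →L[ℝ] L2 T) (SobolevH0.wderiv (M d) 0) =
      (volterra hT.le ^ n : L2 T →L[ℝ] L2 T) (SobolevH0.wderiv (U d) 0) + (d.seq 0).re •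
        (volterra hT.le ^ n : L2 T →L[ℝ] L2 T) (SobolevH0.wderiv v 0) := by
    intro d n
    rw [hM, map_add, map_smul]
  have hprim : ∀ d, ∀ n ≤ k,
      primL T T ((volterra hT.le ^ n : L2 T →L[ℝ] L2 T) (SobolevH0.wderiv (M d) 0)) =
        if n = 0 then (d.seq 0).re else 0 := by
    intro d n hn
    rw [hvol, map_add, (hU d).2.1 n hn, map_smul, hv, map_sub, map_sub, (hU c).2.1 n hn, hW₀,
      hwn n hn]
    split_ifs <;> simp
  set K₁ := ∑ m : Fin (k + 1), ‖SobolevH0.wderiv v m‖ with hK₁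
  set K₂ := ∑ n ∈ Finset.range (k + 2),
    ‖(volterra hT.le ^ n : L2 T →L[ℝ] L2 T) (SobolevH0.wderiv v 0)‖ with hK₂
  have hK₁0 : 0 ≤ K₁ := Finset.sum_nonneg fun _ _ => norm_nonneg _
  have hK₂0 : 0 ≤ K₂ := Finset.sum_nonneg fun _ _ => norm_nonneg _
  -- `K₁` and `K₂` bound the norms of the fixed function `v`; the final `1` pays for the term
  -- `|u_1(T)| = |d_0|` in the negative norms.
  refine ⟨C + K₁ + K₂ + 1, by positivity, M, fun d => ⟨fun j => ?_, fun n h2 hn => ?_,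
    fun m => ?_, fun n h1 hn => ?_⟩⟩
  · change realMoment T (ω j) (SobolevH0.wderiv (M d) 0) = d.seq j
    cases j with
    | zero =>
      have := hprim d 0 (Nat.zero_le _)
      rw [if_pos rfl] at this
      rw [hω0, realMoment_zero hT.le]
      change ((primL T T ((volterra hT.le ^ 0 : L2 T →L[ℝ] L2 T)
        (SobolevH0.wderiv (M d) 0)) : ℝ) : ℂ) = _
      rw [this]
      exact Complex.ext rfl d.seq_mem.1.symm
    | succ j =>
      have hv0 : SobolevH0.wderiv v 0 = hw.toL2 0 + (-1 : ℝ) • SobolevH0.wderiv (U c) 0 := by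
        rw [hv, hW₀, neg_one_smul, sub_eq_add_neg]
      rw [hM, realMoment_add hT.le, realMoment_smul hT.le, hv0, realMoment_add hT.le,
        realMoment_smul hT.le, (hU d).1, (hU c).1, ← hc]
      push_cast
      ring
  · obtain ⟨n, rfl⟩ : ∃ n', n = n' + 1 := ⟨n - 1, by omega⟩
    change iterPrim (SobolevH0.wderiv (M d) 0) (n + 1) T = 0
    rw [iterPrim_succ_apply hT.le, hprim d n (by omega), if_neg (by omega)]
  · have hd := d.abs_re_zero_le hω hω0 (m := ((m : ℕ) : ℤ)) (by omega)
    have hm := (hU d).2.2.1 m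
    have hvm : ‖SobolevH0.wderiv v m‖ ≤ K₁ :=
      Finset.single_le_sum (f := fun m => ‖SobolevH0.wderiv v m‖) (fun _ _ => norm_nonneg _)
        (Finset.mem_univ m)
    unfold SobolevH0.posNorm
    rw [hM]
    refine (norm_add_le _ _).trans ?_
    rw [norm_smul, Real.norm_eq_abs]
    have h0 := (abs_nonneg _).trans hd
    have := mul_le_mul hd hvm (norm_nonneg _) h0
    nlinarith [mul_nonneg hK₂0 h0]
  · have hd := d.abs_re_zero_le hω hω0 (m := -(n : ℤ)) (by omega)
    have hn' := (hU d).2.2.2 n hn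
    have hvn : ‖(volterra hT.le ^ n : L2 T →L[ℝ] L2 T) (SobolevH0.wderiv v 0)‖ ≤ K₂ :=
      Finset.single_le_sum (f := fun n =>
        ‖(volterra hT.le ^ n : L2 T →L[ℝ] L2 T) (SobolevH0.wderiv v 0)‖)
        (fun _ _ => norm_nonneg _) (Finset.mem_range.mpr (by omega))
    change negNorm T n (SobolevH0.wderiv (M d) 0) ≤ _
    have hp := hprim d 0 (Nat.zero_le _)
    rw [if_pos rfl] at hp
    change primL T T (SobolevH0.wderiv (M d) 0) = _ at hp
    rw [negNorm_eq hT.le, hp, hvol]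
    have h3 := norm_add_le ((volterra hT.le ^ n : L2 T →L[ℝ] L2 T) (SobolevH0.wderiv (U d) 0))
      ((d.seq 0).re • (volterra hT.le ^ n : L2 T →L[ℝ] L2 T) (SobolevH0.wderiv v 0))
    rw [norm_smul, Real.norm_eq_abs] at h3
    have h0 := (abs_nonneg _).trans hd
    have := mul_le_mul hd hvn (norm_nonneg _) h0
    nlinarith [mul_nonneg hK₁0 h0]
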